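/- For a graph $G$ and a partition $V(G)=X\sqcup Y$, let $G[X,Y]$ denote the spanning bipartite subgraph of $G$ consisting of all edges of $G$ between $X$ and $Y$. For a bipartite graph $H$ and positive integers $n,s$, let $\mathrm{ex}^*_{\mathrm{bip}}(n,H,s)$ be the minimum $M$ such that, for every $n$-vertex graph $G$ that contains no copy of $K_{s,s}$ as a (not necessarily induced) subgraph and every partition of $V(G)$ into $X,Y$, if $e(G[X,Y])>M$ then $G[X,Y]$ contains a copy of $H$ that is an induced subgraph of $G$. For positive integers $r,t$, let $T_{r,t}$ be the tree obtained from the star with $r$ leaves by joining $t$ new leaves to each leaf of the star, and let $R$ be the set of leaves of $T_{r,t}$. For a positive integer $\ell$, let $F^\ell_{r,t}$ be the $\ell$-th power of $T_{r,t}$ rooted at $R$, that is, the union of $\ell$ copies of $T_{r,t}$ in which, for each $v\in R$, the $\ell$ images of $v$ are identified and which are otherwise pairwise vertex-disjoint. **Theorem.** Let $\ell,r,s,t$ be positive integers with $r\ge t+2\ge 3$. Then, as $n\to\infty$, $$\mathrm{ex}^*_{\mathrm{bip}}(n,F^\ell_{r,t},s)=O\!\left(n^{2-\frac{r+1}{rt+r}}\right),$$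 where the implied constant depends only on $\ell,r,s,t$. -/

import Mathlib

namespace InducedTuran

/-- The spanning bipartite subgraph `G[X, Xᶜ]` contains a copy of `H` that is an induced
subgraph of `G`: there is an embedding of `H` in `G` as an induced subgraph all of whose edges
go between `X` and its complement. -/
def HasInducedCopyAcross {W V : Type*} (H : SimpleGraph W) (G : SimpleGraph V) (X : Set V) :
    Prop :=
  ∃ f : H ↪g G, ∀ u v : W, H.Adj u v → (G.between X Xᶜ).Adj (f u) (f v)

/-- `M` is a threshold for `n`, `H`, `s`: for every `K_{s,s}`-free graph `G` on `n` vertices and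
every partition `X, Xᶜ` of its vertex set, if `G[X, Xᶜ]` has more than `M` edges then it contains
a copy of `H` that is an induced subgraph of `G`. -/
def IsThreshold {W : Type*} (n : ℕ) (H : SimpleGraph W) (s M : ℕ) : Prop :=
  ∀ (G : SimpleGraph (Fin n)) (X : Set (Fin n)),
    (completeBipartiteGraph (Fin s) (Fin s)).Free G →
    M < (G.between X Xᶜ).edgeSet.ncard →
    HasInducedCopyAcross H G X

/-- The bipartite induced Turán number `ex*_bip(n, H, s)`: the least threshold. -/
noncomputable def exBip {W : Type*} (n : ℕ) (H : SimpleGraph W) (s : ℕ) : ℕ :=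
  sInf {M : ℕ | IsThreshold n H s M}

/-- Thresholds exist, so the infimum in `exBip` is a minimum. -/
theorem isThreshold_exBip {W : Type*} (n : ℕ) (H : SimpleGraph W) (s : ℕ) :
    IsThreshold n H s (exBip n H s) := by
  refine Nat.sInf_mem (s := {M : ℕ | IsThreshold n H s M})
    ⟨(Set.univ : Set (Sym2 (Fin n))).ncard, ?_⟩
  intro G X _ h
  exact absurd (Set.ncard_le_ncard (Set.subset_univ _) Set.finite_univ) (not_le.mpr h)

/-- The `ℓ`-th power of `F` rooted at `R`: `ℓ` copies of `F`, glued along `R` and otherwise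
disjoint. The vertices are the elements of `R` and the pairs `(i, v)` with `i` the label of a
copy and `v` a vertex outside `R`. -/
def rootedPower {V : Type*} (F : SimpleGraph V) (R : Set V) (ℓ : ℕ) :
    SimpleGraph (R ⊕ (Fin ℓ × (Rᶜ : Set V))) where
  Adj
    | .inl a, .inl b => F.Adj a b
    | .inl a, .inr (_, b) => F.Adj a b
    | .inr (_, a), .inl b => F.Adj a b
    | .inr (i, a), .inr (j, b) => i = j ∧ F.Adj a b
  symm := ⟨by
    rintro (a | ⟨i, a⟩) (b | ⟨j, b⟩) h
    · exact h.symm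
    · exact h.symm
    · exact h.symm
    · exact ⟨h.1.symm, h.2.symm⟩⟩
  loopless := ⟨by
    rintro (a | ⟨i, a⟩) h
    · exact h.ne rfl
    · exact h.2.ne rfl⟩

/-- The set of leaves (vertices of degree one) of a graph. -/
def leaves {V : Type*} (G : SimpleGraph V) : Set V :=
  {v | ∃! w, G.Adj v w}

/-- The height-two tree `T_{r,t}`: the centre `inl ()` is joined to the `r` vertices
`inr (inl i)`, and each `inr (inl i)` is joined to the `t` vertices `inr (inr (i, j))`. -/
def heightTwoTree (r t : ℕ) : SimpleGraph (Unit ⊕ Fin r ⊕ Fin r × Fin t) :=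
  SimpleGraph.fromRel fun u v =>
    match u, v with
    | .inl _, .inr (.inl _) => True
    | .inr (.inl i), .inr (.inr (k, _)) => i = k
    | _, _ => False

/-- The graph `F^ℓ_{r,t}`: the `ℓ`-th power of `T_{r,t}` rooted at its set of leaves. -/
def heightTwoPower (r t ℓ : ℕ) :=
  rootedPower (heightTwoTree r t) (leaves (heightTwoTree r t)) ℓ

end InducedTuran

namespace InducedTuran

open Finset Function
open scoped Classical

/-! The engine is random embedding in a sparse host. By `exists_clash_bound`, vertices drawn from
two large sets of a `K_{s,s}`-free graph rarely coincide or are adjacent. So if every two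
non-adjacent vertices of a random copy can be resampled independently in large sets, a union bound
removes all unwanted coincidences and edges at once, and the copy becomes induced.

After passing to an almost regular piece (`exists_almost_regular_subset`), degrees are at most `Δ`,
there are of order `nΔ` edges, and `Δ ≥ C n^a` with `a = (rt-1)/(r(t+1))`; the exponent of the
theorem is `1 + a`. Suppose there is no induced power. If all non-clashing `(t+1)`-tuples in a large
set had many common neighbours, random leaves and centres, followed by random common neighbours,
would give the power. Hence a positive proportion of the tuples in any large set is light
(`exists_card_lightTuples_ge`). Convexity then yields of order `nΔ^(r(t+1))` good copies of
`T_{r,t}` (`exists_card_goodCopies_ge`).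

There are only `n^(rt)` leaf tuples, and `nΔ^(r(t+1)) ≥ C n^(rt)`, so a positive proportion of the
good copies have leaves shared by many others. Lightness bounds the copies with given leaves and
centre, so a sunflower appears: `N` copies that agree in the middle vertices on a set `S` of
branches and are otherwise separate. If `S = ∅`, then `ℓ` random petals form an induced power.

If `S ≠ ∅`, it is shrunk (`exists_card_isKernel_erase_ge`). Suppose many copies are kernels for `S`
but not for `S.erase i`. Fix a popular choice of everything prescribed off branch `i`, and let `Z`
be the set of centres that remain. Each leaf tuple on branch `i` now occurs with boundedly many
middle vertices, so `O((n/Δ)^t)` middle vertices carry of order `Δ^t` leaf tuples each, and these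
still receive of order `Δ|Z|` edges from `Z`. Each light tuple in `Z` has fewer than `L` common
neighbours, so convexity forces `Δ^(t+1) = O((n/Δ)^(t²))`. This contradicts the size of `Δ` because
`rt ≥ t² + t + 1`, which is where `r ≥ t + 2` is used. -/

/-- Two vertices clash if they are equal or adjacent. -/
def Clash {V : Type} (G : SimpleGraph V) (u v : V) : Prop := u = v ∨ G.Adj u v

theorem Clash.symm {V : Type} {G : SimpleGraph V} {u v : V} (h : Clash G u v) : Clash G v u :=
  h.elim (fun h => Or.inl h.symm) (fun h => Or.inr h.symm)

/-! ### Resampling coordinates and the union bound -/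

theorem sum_sum_update {κ : Type} [Fintype κ] [DecidableEq κ] {Ω : κ → Type} [∀ c, Fintype (Ω c)]
    (F : (∀ c, Ω c) → ℕ) (p : κ) :
    ∑ ω, ∑ a, F (update ω p a) = Fintype.card (Ω p) * ∑ ω, F ω := by
  have h1 : ∑ ω, ∑ a, F (update ω p a) = ∑ x : (∀ c, Ω c) × Ω p, F (update x.1 p x.2) :=
    (Fintype.sum_prod_type' (fun ω a => F (update ω p a))).symm
  have h2 : Fintype.card (Ω p) * ∑ ω, F ω = ∑ x : (∀ c, Ω c) × Ω p, F x.1 := by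
    rw [Fintype.sum_prod_type' (fun ω _ => F ω), mul_sum]
    simp
  rw [h1, h2]
  -- Exchanging the new value with the old coordinate is an involution.
  refine Finset.sum_nbij' (fun x => (update x.1 p x.2, x.1 p)) (fun x => (update x.1 p x.2, x.1 p))
    ?_ ?_ ?_ ?_ ?_ <;> simp

/-- An event that has density at most `η` in two coordinates, whatever the others are, has density
at most `η`. -/
theorem card_filter_le_of_pair {κ : Type} [Fintype κ] [DecidableEq κ] {Ω : κ → Type} [∀ c, Fintype (Ω c)]
    (E : (∀ c, Ω c) → Prop) (p q : κ) (η : ℝ)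
    (h : ∀ ω, (#{ab : Ω p × Ω q | E (update (update ω q ab.2) p ab.1)} : ℝ)
      ≤ η * Fintype.card (Ω p) * Fintype.card (Ω q)) :
    (#{ω | E ω} : ℝ) ≤ η * Fintype.card (∀ c, Ω c) := by
  by_cases hne : IsEmpty (∀ c, Ω c)
  · simp
  rw [not_isEmpty_iff] at hne
  obtain ⟨ω₀⟩ := hne
  have hp : (0 : ℝ) < Fintype.card (Ω p) := by exact_mod_cast Fintype.card_pos_iff.2 ⟨ω₀ p⟩
  have hq : (0 : ℝ) < Fintype.card (Ω q) := by exact_mod_cast Fintype.card_pos_iff.2 ⟨ω₀ q⟩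
  set F : (∀ c, Ω c) → ℕ := fun ω => if E ω then 1 else 0 with hF
  have h1 : #{ω | E ω} = ∑ ω, F ω := by rw [card_filter]
  have h2 : ∑ ω, ∑ b, ∑ a, F (update (update ω q b) p a)
      = Fintype.card (Ω q) * (Fintype.card (Ω p) * ∑ ω, F ω) := by
    rw [sum_sum_update (fun ω => ∑ a, F (update ω p a)) q, sum_sum_update]
  have h3 : ∀ ω, ∑ b, ∑ a, F (update (update ω q b) p a)
      = #{ab : Ω p × Ω q | E (update (update ω q ab.2) p ab.1)} := by
    intro ω
    rw [card_filter, Fintype.sum_prod_type_right]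
  have h4 : ((∑ ω, ∑ b, ∑ a, F (update (update ω q b) p a) : ℕ) : ℝ)
      ≤ ∑ _ω : (∀ c, Ω c), η * Fintype.card (Ω p) * Fintype.card (Ω q) := by
    push_cast [h3]
    exact sum_le_sum fun ω _ => by simpa [h3] using h ω
  rw [h2, ← h1] at h4
  push_cast at h4
  simp only [sum_const, card_univ, nsmul_eq_mul] at h4
  have : (Fintype.card (Ω q) * Fintype.card (Ω p) : ℝ) * (#{ω | E ω} : ℝ)
      ≤ (Fintype.card (Ω q) * Fintype.card (Ω p) : ℝ) * (η * Fintype.card (∀ c, Ω c)) := by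
    nlinarith
  exact le_of_mul_le_mul_left this (by positivity)

/-- Union bound. -/
theorem exists_avoiding {Ω I : Type} [Fintype Ω] [Nonempty Ω] [Fintype I] (E : I → Ω → Prop) (η : ℝ)
    (h : ∀ i, (#{ω | E i ω} : ℝ) ≤ η * Fintype.card Ω) (hη : Fintype.card I * η < 1) :
    ∃ ω, ∀ i, ¬ E i ω := by
  by_contra hcon
  push Not at hcon
  have h1 : (univ : Finset Ω) ⊆ univ.biUnion fun i => ({ω | E i ω} : Finset Ω) := by
    intro ω _
    obtain ⟨i, hi⟩ := hcon ω
    simp only [mem_biUnion, mem_univ, true_and, mem_filter]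
    exact ⟨i, hi⟩
  have h2 := (card_le_card h1).trans card_biUnion_le
  have h3 : (Fintype.card Ω : ℝ) ≤ ∑ i, (#{ω | E i ω} : ℝ) := by
    rw [card_univ] at h2; exact_mod_cast h2
  have h4 : ∑ i, (#{ω | E i ω} : ℝ) ≤ ∑ _i : I, η * Fintype.card Ω := sum_le_sum fun i _ => h i
  simp only [sum_const, card_univ, nsmul_eq_mul] at h4
  have : (0 : ℝ) < Fintype.card Ω := by exact_mod_cast Fintype.card_pos
  nlinarith

/-! ### Few clashes between large sets -/

/-- Power mean inequality. -/
theorem pow_sum_le_mul_sum_pow {ι : Type} (A : Finset ι) (f : ι → ℝ) (hf : ∀ i ∈ A, 0 ≤ f i) (k : ℕ)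
    (M : ℝ) (hM : (#A : ℝ) ≤ M) :
    (∑ i ∈ A, f i) ^ (k + 1) ≤ M ^ k * ∑ i ∈ A, f i ^ (k + 1) := by
  refine (pow_sum_le_card_mul_sum_pow hf k).trans ?_
  gcongr
  exact sum_nonneg fun i hi => pow_nonneg (hf i hi) _

/-- Union bound over ordered pairs of positions, each of which collides with probability `1 / card
δ`. -/
theorem card_not_injective_le {δ : Type} [Fintype δ] (s : ℕ) (hδ : 0 < Fintype.card δ) :
    (#{h : Fin s → δ | ¬ Injective h} : ℝ) ≤ s ^ 2 * (Fintype.card δ : ℝ)⁻¹ * Fintype.card δ ^ s := by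
  have hδ' : (0 : ℝ) < Fintype.card δ := by exact_mod_cast hδ
  have h1 : ({h : Fin s → δ | ¬ Injective h} : Finset _) ⊆
      ({p : Fin s × Fin s | p.1 ≠ p.2} : Finset _).biUnion
        fun p => ({h : Fin s → δ | h p.1 = h p.2} : Finset _) := by
    intro h hh
    simp only [mem_filter, mem_univ, true_and, Injective, not_forall] at hh
    obtain ⟨a, b, hab, hne⟩ := hh
    simp only [mem_biUnion, mem_filter, mem_univ, true_and]
    exact ⟨(a, b), hne, hab⟩
  have h2 : ∀ p ∈ ({p : Fin s × Fin s | p.1 ≠ p.2} : Finset _),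
      (#{h : Fin s → δ | h p.1 = h p.2} : ℝ) ≤ (Fintype.card δ : ℝ)⁻¹ * Fintype.card δ ^ s := by
    intro p hp
    have hp : p.1 ≠ p.2 := by simpa using hp
    have := card_filter_le_of_pair (Ω := fun _ : Fin s => δ) (fun h => h p.1 = h p.2) p.1 p.2
      (Fintype.card δ : ℝ)⁻¹ (by
        intro ω
        have h3 : ({ab : δ × δ | update (update ω p.2 ab.2) p.1 ab.1 p.1
            = update (update ω p.2 ab.2) p.1 ab.1 p.2} : Finset _) ⊆ univ.image fun a => (a, a) := by
          intro ab hab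
          simp only [mem_filter, mem_univ, true_and, update_self, update_of_ne hp.symm] at hab
          simp only [mem_image, mem_univ, true_and]
          exact ⟨ab.1, by rw [Prod.ext_iff]; exact ⟨rfl, hab⟩⟩
        have h4 := (card_le_card h3).trans card_image_le
        rw [card_univ] at h4
        rw [inv_mul_cancel₀ hδ'.ne', one_mul]
        exact_mod_cast h4)
    simpa using this
  have h5 : (#{h : Fin s → δ | ¬ Injective h} : ℝ) ≤
      ∑ p ∈ ({p : Fin s × Fin s | p.1 ≠ p.2} : Finset _), (#{h : Fin s → δ | h p.1 = h p.2} : ℝ) := by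
    exact_mod_cast (card_le_card h1).trans card_biUnion_le
  refine h5.trans ((sum_le_sum h2).trans ?_)
  rw [sum_const, nsmul_eq_mul, mul_assoc]
  refine mul_le_mul_of_nonneg_right ?_ (by positivity)
  have : #({p : Fin s × Fin s | p.1 ≠ p.2} : Finset _) ≤ s ^ 2 := by
    refine (card_filter_le _ _).trans ?_
    simp [sq]
  exact_mod_cast this

theorem not_free_of_injective {V : Type} {G : SimpleGraph V} {s : ℕ} (f g : Fin s → V)
    (hf : Injective f) (hg : Injective g) (h : ∀ i j, G.Adj (f i) (g j)) :
    ¬ (completeBipartiteGraph (Fin s) (Fin s)).Free G := by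
  rw [SimpleGraph.Free, not_not]
  refine ⟨⟨⟨Sum.elim f g, ?_⟩, ?_⟩⟩
  · rintro (a | a) (b | b) hab
    · simp at hab
    · exact h a b
    · exact (h b a).symm
    · simp at hab
  · rintro (a | a) (b | b) hab
    · exact congrArg _ (hf hab)
    · exact absurd hab (h a b).ne
    · exact absurd hab.symm (h b a).ne
    · exact congrArg _ (hg hab)

/-- Kővári–Sós–Turán, qualitatively: in a `K_{s,s}`-free graph, few pairs from two large sets
clash. -/
theorem exists_clash_bound (s : ℕ) (hs : 1 ≤ s) (η : ℝ) (hη : 0 < η) :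
    ∃ N₀ : ℕ, 0 < N₀ ∧ ∀ (V : Type) (G : SimpleGraph V),
      (completeBipartiteGraph (Fin s) (Fin s)).Free G →
      ∀ (γ δ : Type) [Fintype γ] [Fintype δ] (f : γ → V) (g : δ → V), Injective f → Injective g →
        N₀ ≤ Fintype.card γ → N₀ ≤ Fintype.card δ →
        (#{p : γ × δ | Clash G (f p.1) (g p.2)} : ℝ)
          ≤ η * Fintype.card γ * Fintype.card δ := by
  -- By convexity, edge density `η / 2` forces density `k` of pairs of a vertex and an `s`-tuple of
  -- its neighbours. The three bounds on `N₀` absorb, in this order, the equality clashes (at most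
  -- one per element of `γ`), the injective tuples and the non-injective ones; the last two get `k /
  -- 3` each.
  set k : ℝ := (η / 2) ^ s with hk
  have hk0 : 0 < k := by positivity
  obtain ⟨N₀, hN₀⟩ := exists_nat_gt (2 / η + 3 * s / k + 3 * s ^ 2 / k)
  have hN₁ : 2 / η < N₀ := by
    refine lt_of_le_of_lt ?_ hN₀
    have : 0 ≤ 3 * s / k + 3 * s ^ 2 / k := by positivity
    linarith
  have hN₂ : 3 * s / k < N₀ := by
    refine lt_of_le_of_lt ?_ hN₀
    have : 0 ≤ 2 / η + 3 * s ^ 2 / k := by positivity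
    linarith
  have hN₃ : 3 * s ^ 2 / k < N₀ := by
    refine lt_of_le_of_lt ?_ hN₀
    have : 0 ≤ 2 / η + 3 * s / k := by positivity
    linarith
  have hN0pos : (0 : ℝ) < N₀ := lt_trans (by positivity) hN₁
  refine ⟨N₀, by exact_mod_cast hN0pos, ?_⟩
  intro V G hfree γ δ _ _ f g hf hg hγ hδ
  by_contra hcon
  push Not at hcon
  have hγ' : (N₀ : ℝ) ≤ Fintype.card γ := by exact_mod_cast hγ
  have hδ' : (N₀ : ℝ) ≤ Fintype.card δ := by exact_mod_cast hδ
  set a : ℝ := (Fintype.card γ : ℝ)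
  set b : ℝ := (Fintype.card δ : ℝ)
  have ha : 0 < a := hN0pos.trans_le hγ'
  have hb : 0 < b := hN0pos.trans_le hδ'
  have hdeg : (#{p : γ × δ | Clash G (f p.1) (g p.2)} : ℝ)
      ≤ ∑ u, ((#{v | G.Adj (f u) (g v)} : ℝ) + 1) := by
    have : #{p : γ × δ | Clash G (f p.1) (g p.2)} ≤ ∑ u, (#{v | G.Adj (f u) (g v)} + 1) := by
      rw [card_filter, Fintype.sum_prod_type]
      refine sum_le_sum fun u _ => ?_
      rw [← card_filter]
      have h1 : ({v | Clash G (f u) (g v)} : Finset δ)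
          ⊆ ({v | G.Adj (f u) (g v)} : Finset δ) ∪ ({v | f u = g v} : Finset δ) := by
        intro v hv
        rw [mem_filter] at hv
        rw [mem_union, mem_filter, mem_filter]
        exact (Or.symm hv.2).imp (⟨mem_univ _, ·⟩) (⟨mem_univ _, ·⟩)
      refine (card_le_card h1).trans ((card_union_le _ _).trans ?_)
      gcongr
      rw [card_le_one]
      intro v hv w hw
      simp only [mem_filter, mem_univ, true_and] at hv hw
      exact hg (hv.symm.trans hw)
    exact_mod_cast this
  rw [sum_add_distrib] at hdeg
  simp only [sum_const, card_univ, nsmul_eq_mul, mul_one] at hdeg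
  have hsum : η / 2 * a * b < ∑ u, (#{v | G.Adj (f u) (g v)} : ℝ) := by
    have h1 : 2 < b * η := by rw [div_lt_iff₀ hη] at hN₁; nlinarith
    have : a ≤ η / 2 * a * b := by nlinarith
    have h2 : η * a * b < ∑ u, (#{v | G.Adj (f u) (g v)} : ℝ) + a := hcon.trans_le hdeg
    linarith
  obtain ⟨s', rfl⟩ : ∃ s', s = s' + 1 := ⟨s - 1, by omega⟩
  have hpow := pow_sum_le_mul_sum_pow (univ : Finset γ)
    (fun u => (#{v | G.Adj (f u) (g v)} : ℝ)) (fun _ _ => by positivity) s' a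
    (by rw [card_univ])
  have hlow : k * a * b ^ (s' + 1) < ∑ u, (#{v | G.Adj (f u) (g v)} : ℝ) ^ (s' + 1) := by
    have h1 : (η / 2 * a * b) ^ (s' + 1)
        < a ^ s' * ∑ u, (#{v | G.Adj (f u) (g v)} : ℝ) ^ (s' + 1) :=
      (pow_lt_pow_left₀ hsum (by positivity) (by omega)).trans_le hpow
    have h2 : (η / 2 * a * b) ^ (s' + 1) = a ^ s' * (k * a * b ^ (s' + 1)) := by
      rw [hk]; ring
    rw [h2] at h1
    exact lt_of_mul_lt_mul_left h1 (by positivity)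
  have hcount : ∑ u, (#{v | G.Adj (f u) (g v)} : ℝ) ^ (s' + 1)
      = ∑ h : Fin (s' + 1) → δ, (#{u | ∀ i, G.Adj (f u) (g (h i))} : ℝ) := by
    have h1 : ∀ u, #{v | G.Adj (f u) (g v)} ^ (s' + 1)
        = #{h : Fin (s' + 1) → δ | ∀ i, G.Adj (f u) (g (h i))} := by
      intro u
      have : ({h : Fin (s' + 1) → δ | ∀ i, G.Adj (f u) (g (h i))} : Finset _)
          = Fintype.piFinset fun _ => ({v | G.Adj (f u) (g v)} : Finset δ) := by
        ext h; simp
      rw [this]; simp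
    have h2 : ∑ u, #{v | G.Adj (f u) (g v)} ^ (s' + 1)
        = ∑ h : Fin (s' + 1) → δ, #{u | ∀ i, G.Adj (f u) (g (h i))} := by
      simp_rw [h1, card_filter]
      exact sum_comm
    exact_mod_cast h2
  have hup : ∀ h : Fin (s' + 1) → δ, (#{u | ∀ i, G.Adj (f u) (g (h i))} : ℝ)
      ≤ (s' + 1 : ℕ) + (if ¬ Injective h then a else 0) := by
    intro h
    by_cases hh : Injective h
    · simp only [hh, not_true_eq_false, if_false, add_zero]
      by_contra hlt
      push Not at hlt
      have hlt : s' + 1 < #{u | ∀ i, G.Adj (f u) (g (h i))} := by exact_mod_cast hlt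
      obtain ⟨Q, hQ, hQc⟩ := exists_subset_card_eq hlt.le
      let e := Q.equivFinOfCardEq hQc
      refine not_free_of_injective (G := G) (fun i => f (e.symm i)) (fun i => g (h i)) ?_ ?_ ?_ hfree
      · intro i j hij
        exact e.symm.injective (Subtype.ext (hf hij))
      · exact hg.comp hh
      · intro i j
        have := hQ (e.symm i).2
        simp only [mem_filter, mem_univ, true_and] at this
        exact this j
    · simp only [hh, not_false_eq_true, if_true]
      have : (#{u | ∀ i, G.Adj (f u) (g (h i))} : ℝ) ≤ a := by
        simp only [a]
        exact_mod_cast card_le_univ _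
      have h0 : (0 : ℝ) ≤ (s' + 1 : ℕ) := by positivity
      linarith
  have htot := hlow.trans_le (hcount.le.trans (sum_le_sum fun h _ => hup h))
  rw [sum_add_distrib, ← sum_filter] at htot
  simp only [sum_const, card_univ, nsmul_eq_mul, Fintype.card_fun, Fintype.card_fin] at htot
  have hni := card_not_injective_le (δ := δ) (s' + 1) (Nat.cast_pos.1 hb)
  push_cast at htot hni hN₂ hN₃
  change _ < b ^ (s' + 1) * _ + _ at htot
  change _ ≤ _ * b⁻¹ * b ^ (s' + 1) at hni
  have hbs : 0 < b ^ (s' + 1) := by positivity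
  have e1 : 3 * ((s' : ℝ) + 1) < k * a := by
    rw [div_lt_iff₀ hk0] at hN₂; nlinarith
  have e2 : ((s' : ℝ) + 1) ^ 2 * b⁻¹ ≤ k / 3 := by
    rw [div_lt_iff₀ hk0] at hN₃
    rw [← div_eq_mul_inv, div_le_iff₀ hb]; nlinarith
  have e3 : (#{h : Fin (s' + 1) → δ | ¬ Injective h} : ℝ) * a ≤ k / 3 * b ^ (s' + 1) * a := by
    refine mul_le_mul_of_nonneg_right (hni.trans ?_) ha.le
    exact mul_le_mul_of_nonneg_right e2 hbs.le
  have e4 : b ^ (s' + 1) * ((s' : ℝ) + 1) ≤ b ^ (s' + 1) * (k * a / 3) := by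
    refine mul_le_mul_of_nonneg_left ?_ hbs.le
    linarith
  have e5 : 0 < k * a * b ^ (s' + 1) := by positivity
  nlinarith

/-- In a random choice of coordinates, two vertices that are controlled injectively by different
coordinates, neither depending on the other one's, clash with small probability. -/
theorem clash_fraction_le {V : Type} {G : SimpleGraph V} {κ : Type} [Fintype κ] [DecidableEq κ] {Ω : κ → Type}
    [∀ c, Fintype (Ω c)] {η : ℝ} {N₀ : ℕ}
    (hN : ∀ (γ δ : Type) [Fintype γ] [Fintype δ] (f : γ → V) (g : δ → V), Injective f → Injective g →
        N₀ ≤ Fintype.card γ → N₀ ≤ Fintype.card δ →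
        (#{p : γ × δ | Clash G (f p.1) (g p.2)} : ℝ) ≤ η * Fintype.card γ * Fintype.card δ)
    (u v : (∀ c, Ω c) → V) (p q : κ) (hpq : p ≠ q)
    (hup : ∀ ω, Injective fun a => u (update ω p a)) (hvq : ∀ ω, Injective fun b => v (update ω q b))
    (huq : ∀ ω b, u (update ω q b) = u ω) (hvp : ∀ ω a, v (update ω p a) = v ω)
    (hp : N₀ ≤ Fintype.card (Ω p)) (hq : N₀ ≤ Fintype.card (Ω q)) :
    (#{ω | Clash G (u ω) (v ω)} : ℝ) ≤ η * Fintype.card (∀ c, Ω c) := by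
  refine card_filter_le_of_pair _ p q η fun ω => ?_
  refine le_trans (le_of_eq ?_) (hN (Ω p) (Ω q) _ _ (hup ω) (hvq ω) hp hq)
  congr 2
  ext ab
  simp only [mem_filter, mem_univ, true_and]
  rw [hvp, update_comm hpq.symm, huq]

/-! ### The power graph in coordinates -/

/-- The vertices of `F^ℓ_{r,t}`: the leaves, the `ℓ` centres and the `ℓ` copies of the `r` middle
vertices. -/
abbrev PowerVertex (r t ℓ : ℕ) : Type := (Fin r × Fin t) ⊕ (Fin ℓ ⊕ Fin ℓ × Fin r)

/-- Adjacency of `F^ℓ_{r,t}`. -/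
def PowerAdj {r t ℓ : ℕ} : PowerVertex r t ℓ → PowerVertex r t ℓ → Prop
  | .inl (i, _), .inr (.inr (_, k)) => i = k
  | .inr (.inr (_, k)), .inl (i, _) => i = k
  | .inr (.inl a), .inr (.inr (b, _)) => a = b
  | .inr (.inr (b, _)), .inr (.inl a) => a = b
  | _, _ => False

/-- The placement of the vertices of `F^ℓ_{r,t}` given by the leaves `x`, the centres `z` and the
middle vertices `y`. -/
def placement {α β : Type} {r t ℓ : ℕ} (x : Fin r × Fin t → α) (z : Fin ℓ → α)
    (y : Fin ℓ × Fin r → β) : PowerVertex r t ℓ → α ⊕ β :=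
  Sum.elim (fun p => .inl (x p)) (Sum.elim (fun a => .inl (z a)) (fun p => .inr (y p)))

/-- `G` contains `F^ℓ_{r,t}` as an induced subgraph, with the leaves and the centres in `α` and the
middle vertices in `β`. -/
def HasPower {α β : Type} (G : SimpleGraph (α ⊕ β)) (r t ℓ : ℕ) : Prop :=
  ∃ (x : Fin r × Fin t → α) (z : Fin ℓ → α) (y : Fin ℓ × Fin r → β),
    ∀ p q, p ≠ q → (PowerAdj p q → G.Adj (placement x z y p) (placement x z y q)) ∧
      (¬ PowerAdj p q → ¬ Clash G (placement x z y p) (placement x z y q))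

/-- For `r ≥ 2` and `t ≥ 1` neither the centre nor a middle vertex has degree one, so the roots are
exactly the bottom layer. -/
theorem leaf_mem {r t : ℕ} (p : Fin r × Fin t) :
    (.inr (.inr p) : Unit ⊕ Fin r ⊕ Fin r × Fin t) ∈ leaves (heightTwoTree r t) := by
  refine ⟨.inr (.inl p.1), ?_, ?_⟩
  · simp [heightTwoTree, SimpleGraph.fromRel_adj]
  · rintro (_ | i | q) h
    · simp [heightTwoTree, SimpleGraph.fromRel_adj] at h
    · simp [heightTwoTree, SimpleGraph.fromRel_adj] at h
      rw [h]
    · simp [heightTwoTree, SimpleGraph.fromRel_adj] at h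

theorem centre_notMem_leaves {r t : ℕ} (hr : 2 ≤ r) :
    (.inl () : Unit ⊕ Fin r ⊕ Fin r × Fin t) ∉ leaves (heightTwoTree r t) := by
  rintro ⟨w, -, hw⟩
  have h0 := hw (.inr (.inl ⟨0, by omega⟩)) (by simp [heightTwoTree, SimpleGraph.fromRel_adj])
  have h1 := hw (.inr (.inl ⟨1, by omega⟩)) (by simp [heightTwoTree, SimpleGraph.fromRel_adj])
  simpa using h0.trans h1.symm

theorem middle_notMem_leaves {r t : ℕ} (ht : 1 ≤ t) (i : Fin r) :
    (.inr (.inl i) : Unit ⊕ Fin r ⊕ Fin r × Fin t) ∉ leaves (heightTwoTree r t) := by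
  rintro ⟨w, -, hw⟩
  have h0 := hw (.inl ()) (by simp [heightTwoTree, SimpleGraph.fromRel_adj])
  have h1 := hw (.inr (.inr (i, ⟨0, ht⟩))) (by simp [heightTwoTree, SimpleGraph.fromRel_adj])
  simpa using h0.trans h1.symm

/-- The correspondence between the vertices of `heightTwoPower r t ℓ` and `PowerVertex r t ℓ`. -/
def Codes {r t ℓ : ℕ} :
    (leaves (heightTwoTree r t)) ⊕ (Fin ℓ × ((leaves (heightTwoTree r t))ᶜ : Set _)) →
    PowerVertex r t ℓ → Prop
  | .inl v, .inl p => v.1 = .inr (.inr p)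
  | .inr (a, v), .inr (.inl b) => a = b ∧ v.1 = .inl ()
  | .inr (a, v), .inr (.inr (b, i)) => a = b ∧ v.1 = .inr (.inl i)
  | _, _ => False

theorem exists_codes {r t ℓ : ℕ} (hr : 2 ≤ r) (ht : 1 ≤ t)
    (p : (leaves (heightTwoTree r t)) ⊕ (Fin ℓ × ((leaves (heightTwoTree r t))ᶜ : Set _))) :
    ∃ c : PowerVertex r t ℓ, Codes p c := by
  rcases p with ⟨v, hv⟩ | ⟨a, v, hv⟩
  · rcases v with ⟨⟩ | i | q
    · exact absurd hv (centre_notMem_leaves hr)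
    · exact absurd hv (middle_notMem_leaves ht i)
    · exact ⟨.inl q, rfl⟩
  · rcases v with ⟨⟩ | i | q
    · exact ⟨.inr (.inl a), rfl, rfl⟩
    · exact ⟨.inr (.inr (a, i)), rfl, rfl⟩
    · exact absurd (leaf_mem q) hv

theorem Codes.injective {r t ℓ : ℕ}
    {p q : (leaves (heightTwoTree r t)) ⊕ (Fin ℓ × ((leaves (heightTwoTree r t))ᶜ : Set _))}
    {c : PowerVertex r t ℓ} (hp : Codes p c) (hq : Codes q c) : p = q := by
  rcases p with ⟨v, hv⟩ | ⟨a, v, hv⟩ <;> rcases q with ⟨w, hw⟩ | ⟨b, w, hw⟩ <;>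
    rcases c with c | c | ⟨c, i⟩ <;> simp_all [Codes]

theorem Codes.adj_iff {r t ℓ : ℕ}
    {p q : (leaves (heightTwoTree r t)) ⊕ (Fin ℓ × ((leaves (heightTwoTree r t))ᶜ : Set _))}
    {c d : PowerVertex r t ℓ} (hp : Codes p c) (hq : Codes q d) :
    (heightTwoPower r t ℓ).Adj p q ↔ PowerAdj c d := by
  rcases p with ⟨v, hv⟩ | ⟨a, v, hv⟩ <;> rcases q with ⟨w, hw⟩ | ⟨b, w, hw⟩ <;>
    rcases c with ⟨c, k⟩ | c | ⟨c, i⟩ <;> rcases d with ⟨d, k'⟩ | d | ⟨d, j⟩ <;>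
    simp only [Codes] at hp hq <;>
    simp_all [heightTwoPower, rootedPower, heightTwoTree, PowerAdj, SimpleGraph.fromRel_adj, eq_comm]

/-- The middle vertices form one colour class, so placing exactly these in `β` sends every edge
across the cut. -/
theorem PowerAdj.crosses {r t ℓ : ℕ} {c d : PowerVertex r t ℓ} (h : PowerAdj c d) :
    ((∀ q, c ≠ .inr (.inr q)) ∧ ¬ ∀ q, d ≠ .inr (.inr q)) ∨
      ((¬ ∀ q, c ≠ .inr (.inr q)) ∧ ∀ q, d ≠ .inr (.inr q)) := by
  rcases c with ⟨c, k⟩ | c | ⟨c, i⟩ <;> rcases d with ⟨d, k'⟩ | d | ⟨d, j⟩ <;> simp_all [PowerAdj]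

/-- An induced copy in the graph spanned by two vertex families on the two sides of a cut is an
induced copy across the cut. -/
theorem HasPower.hasInducedCopyAcross {V α β : Type} {r t ℓ : ℕ} (hr : 2 ≤ r) (ht : 1 ≤ t)
    (G : SimpleGraph V) (X : Set V) (f : α → V) (g : β → V) (hinj : Injective (Sum.elim f g))
    (hf : ∀ a, f a ∈ X) (hg : ∀ b, g b ∉ X)
    (h : HasPower (G.comap (Sum.elim f g)) r t ℓ) :
    HasInducedCopyAcross (heightTwoPower r t ℓ) G X := by
  obtain ⟨x, z, y, h⟩ := h
  choose code hcode using exists_codes (r := r) (t := t) (ℓ := ℓ) hr ht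
  have hside : ∀ p, Sum.elim f g (placement x z y p) ∈ X ↔ ∀ q, p ≠ .inr (.inr q) := by
    rintro (p | p | p) <;> simp [placement, hf, hg]
  have hne : ∀ p q, p ≠ q → placement x z y p ≠ placement x z y q := by
    intro p q hpq heq
    by_cases hc : PowerAdj p q
    · exact ((h p q hpq).1 hc).ne (by rw [heq])
    · exact (h p q hpq).2 hc (Or.inl heq)
  have hcinj : Injective code := fun p q hpq =>
    (hcode p).injective (hpq ▸ hcode q)
  have hadj : ∀ p q, G.Adj (Sum.elim f g (placement x z y p)) (Sum.elim f g (placement x z y q)) ↔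
      PowerAdj p q := by
    intro p q
    by_cases hpq : p = q
    · subst hpq
      rcases p with ⟨p, _⟩ | p | p <;> simp [PowerAdj]
    · refine ⟨fun hh => ?_, fun hh => (h p q hpq).1 hh⟩
      by_contra hc
      exact (h p q hpq).2 hc (Or.inr hh)
  refine ⟨⟨⟨fun p => Sum.elim f g (placement x z y (code p)), ?_⟩, ?_⟩, ?_⟩
  · intro p q hpq
    by_contra hc
    exact hne _ _ (fun hh => hc (hcinj hh)) (hinj hpq)
  · intro p q
    exact (hadj _ _).trans (Codes.adj_iff (hcode p) (hcode q)).symm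
  · intro p q hpq
    have hc := (Codes.adj_iff (hcode p) (hcode q)).1 hpq
    have ha := (hadj _ _).2 hc
    have hx : (Sum.elim f g (placement x z y (code p)) ∈ X ∧
        Sum.elim f g (placement x z y (code q)) ∈ Xᶜ) ∨
        (Sum.elim f g (placement x z y (code p)) ∈ Xᶜ ∧
        Sum.elim f g (placement x z y (code q)) ∈ X) := by
      simp only [Set.mem_compl_iff, hside]
      exact hc.crosses
    rw [SimpleGraph.between_adj]
    exact ⟨ha, by tauto⟩

theorem PowerAdj.symm {r t ℓ : ℕ} {c d : PowerVertex r t ℓ} (h : PowerAdj c d) : PowerAdj d c := by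
  rcases c with ⟨c, k⟩ | c | ⟨c, i⟩ <;> rcases d with ⟨d, k'⟩ | d | ⟨d, j⟩ <;> simp_all [PowerAdj]

/-! ### Light tuples -/

/-- The common neighbours in `β` of `z` and `x 0, …, x (t - 1)`. -/
noncomputable def commonNbrs {α β : Type} [Fintype β] (G : SimpleGraph (α ⊕ β)) {t : ℕ} (z : α)
    (x : Fin t → α) : Finset β :=
  {y | G.Adj (.inl z) (.inr y) ∧ ∀ j, G.Adj (.inl (x j)) (.inr y)}

/-- A tuple of `t + 1` vertices is light if no two of them clash and it has fewer than `L` common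
neighbours. -/
def Light {α β : Type} [Fintype β] (G : SimpleGraph (α ⊕ β)) {t : ℕ} (L : ℕ) (z : α)
    (x : Fin t → α) : Prop :=
  #(commonNbrs G z x) < L ∧ (∀ j, ¬ Clash G (.inl z) (.inl (x j))) ∧
    ∀ j k, j ≠ k → ¬ Clash G (.inl (x j)) (.inl (x k))

/-- Otherwise every non-clashing tuple in `P` has many common neighbours. Random leaves and centres
from `P`, with random common neighbours as middle vertices, then form an induced power with positive
probability. The same `N` serves as `L` and as the number of choices for each vertex. -/
theorem exists_light_of_large (s r t ℓ : ℕ) (hs : 1 ≤ s) :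
    ∃ L : ℕ, ∀ (α β : Type) [Fintype α] [Fintype β] (G : SimpleGraph (α ⊕ β)),
      (completeBipartiteGraph (Fin s) (Fin s)).Free G → ¬ HasPower G r t ℓ →
      ∀ P : Finset α, L ≤ #P → ∃ z ∈ P, ∃ x : Fin t → α, (∀ j, x j ∈ P) ∧ Light G L z x := by
  set κ := PowerVertex r t ℓ
  -- There is one bad event per ordered pair of vertices, so this keeps the union bound below 1.
  set η : ℝ := 1 / (Fintype.card (κ × κ) + 1) with hη
  obtain ⟨N, hN0, hN⟩ := exists_clash_bound s hs η (by positivity)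
  refine ⟨N, ?_⟩
  intro α β _ _ G hfree hpow P hP
  by_contra hno
  push Not at hno
  -- If there are fewer than `N` common neighbours, `Y` lists elements of `P` instead, a dummy value
  -- that only keeps it injective.
  have hheavy : ∀ z (x : Fin t → α), ∃ Y : Fin N → α ⊕ β, Injective Y ∧
      (N ≤ #(commonNbrs G z x) → ∀ k, ∃ y ∈ commonNbrs G z x, Y k = .inr y) := by
    intro z x
    by_cases h : N ≤ #(commonNbrs G z x)
    · obtain ⟨Q, hQ, hQc⟩ := exists_subset_card_eq h
      let e := Q.equivFinOfCardEq hQc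
      refine ⟨fun k => .inr (e.symm k), ?_, ?_⟩
      · intro k k' hk
        exact e.symm.injective (Subtype.ext (Sum.inr_injective hk))
      · exact fun _ k => ⟨_, hQ (e.symm k).2, rfl⟩
    · obtain ⟨Q, hQ, hQc⟩ := exists_subset_card_eq hP
      let e := Q.equivFinOfCardEq hQc
      refine ⟨fun k => .inl (e.symm k), ?_, fun h' => absurd h' h⟩
      intro k k' hk
      exact e.symm.injective (Subtype.ext (Sum.inl_injective hk))
  choose Y hYinj hY using hheavy
  obtain ⟨Q, hQ, hQc⟩ := exists_subset_card_eq hP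
  let e : Fin N → α := fun k => ((Q.equivFinOfCardEq hQc).symm k).1
  have heP : ∀ k, e k ∈ P := fun k => hQ ((Q.equivFinOfCardEq hQc).symm k).2
  have heinj : Injective e := fun k k' hk => (Q.equivFinOfCardEq hQc).symm.injective (Subtype.ext hk)
  have : Nonempty (Fin N) := ⟨⟨0, hN0⟩⟩
  let X : (κ → Fin N) → Fin r × Fin t → α := fun ω p => e (ω (.inl p))
  let Z : (κ → Fin N) → Fin ℓ → α := fun ω p => e (ω (.inr (.inl p)))
  let u : (κ → Fin N) → κ → α ⊕ β := fun ω =>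
    Sum.elim (fun p => .inl (X ω p)) (Sum.elim (fun a => .inl (Z ω a))
      (fun p => Y (Z ω p.1) (fun j => X ω (p.2, j)) (ω (.inr (.inr p)))))
  have hX : ∀ ω q b p, Sum.inl p ≠ q → X (update ω q b) p = X ω p := by
    intro ω q b p hpq
    simp only [X, update_of_ne hpq]
  have hZ : ∀ ω q b p, Sum.inr (Sum.inl p) ≠ q → Z (update ω q b) p = Z ω p := by
    intro ω q b p hpq
    simp only [Z, update_of_ne hpq]
  -- A middle vertex depends on its own coordinate and on those of its neighbours only, so
  -- non-adjacent vertices never depend on each other's coordinates.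
  have hindep : ∀ p q, p ≠ q → ¬ PowerAdj p q → ∀ ω b, u (update ω q b) p = u ω p := by
    rintro (p | p | p) q hpq hc ω b
    · simp only [u, Sum.elim_inl, hX ω q b p hpq]
    · simp only [u, Sum.elim_inl, Sum.elim_inr, hZ ω q b p hpq]
    · simp only [u, Sum.elim_inr]
      rw [hZ, update_of_ne hpq]
      · congr 1
        funext j
        rw [hX]
        rintro rfl
        simp [PowerAdj] at hc
      · rintro rfl
        simp [PowerAdj] at hc
  have hinj : ∀ p ω, Injective fun a => u (update ω p a) p := by
    rintro (p | p | p) ω a b hab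
    · simp only [u, X, Sum.elim_inl, update_self] at hab
      exact heinj (Sum.inl_injective hab)
    · simp only [u, Z, Sum.elim_inl, Sum.elim_inr, update_self] at hab
      exact heinj (Sum.inl_injective hab)
    · simp only [u, Sum.elim_inr, update_self] at hab
      rw [hZ _ _ _ _ (by simp), hZ _ _ _ _ (by simp)] at hab
      have hx : ∀ c j, X (update ω (.inr (.inr p)) c) (p.2, j) = X ω (p.2, j) :=
        fun c j => hX _ _ _ _ (by simp)
      simp only [hx] at hab
      exact hYinj _ _ hab
  obtain ⟨ω, hω⟩ := exists_avoiding (I := κ × κ)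
    (fun pq ω => pq.1 ≠ pq.2 ∧ ¬ PowerAdj pq.1 pq.2 ∧ Clash G (u ω pq.1) (u ω pq.2)) η (by
      rintro ⟨p, q⟩
      by_cases h : p ≠ q ∧ ¬ PowerAdj p q
      · refine le_trans ?_ (clash_fraction_le (hN _ G hfree) (fun ω => u ω p) (fun ω => u ω q) p q h.1
          (hinj p) (hinj q) (hindep p q h.1 h.2)
          (hindep q p h.1.symm fun h' => h.2 h'.symm) (Fintype.card_fin N).ge (Fintype.card_fin N).ge)
        gcongr
        exact fun h => h.2.2
      · have : ∀ ω, ¬ (p ≠ q ∧ ¬ PowerAdj p q ∧ Clash G (u ω p) (u ω q)) := by tauto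
        simp only [this]
        simp
        positivity) (by
      rw [hη, mul_one_div, div_lt_one (by positivity)]
      linarith)
  have hclash : ∀ p q, p ≠ q → ¬ PowerAdj p q → ¬ Clash G (u ω p) (u ω q) :=
    fun p q h1 h2 h3 => hω (p, q) ⟨h1, h2, h3⟩
  -- A non-clashing tuple with few common neighbours would be light; hence the dummy values of `Y`
  -- are not used.
  have hcodeg : ∀ p : Fin ℓ × Fin r, N ≤ #(commonNbrs G (Z ω p.1) fun j => X ω (p.2, j)) := by
    intro p
    by_contra hlt
    refine hno (Z ω p.1) (heP _) (fun j => X ω (p.2, j))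
      (fun j => heP _) ⟨not_le.1 hlt, ?_, ?_⟩
    · intro j
      exact hclash (.inr (.inl p.1)) (.inl (p.2, j)) (by simp) (by simp [PowerAdj])
    · intro j k hjk
      exact hclash (.inl (p.2, j)) (.inl (p.2, k)) (by simpa using hjk) (by simp [PowerAdj])
  choose y hy hYy using fun p => hY _ _ (hcodeg p) (ω (.inr (.inr p)))
  have hu : u ω = placement (X ω) (Z ω) y := by
    funext p
    rcases p with p | p | p
    · rfl
    · rfl
    · exact hYy p
  refine hpow ⟨X ω, Z ω, y, fun p q hpq => ⟨?_, ?_⟩⟩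
  · have hy1 : ∀ p, G.Adj (.inl (Z ω p.1)) (.inr (y p)) := fun p => by
      have := hy p
      simp only [commonNbrs, mem_filter, mem_univ, true_and] at this
      exact this.1
    have hy2 : ∀ p j, G.Adj (.inl (X ω (p.2, j))) (.inr (y p)) := fun p => by
      have := hy p
      simp only [commonNbrs, mem_filter, mem_univ, true_and] at this
      exact this.2
    intro h
    rcases p with ⟨c, k⟩ | c | ⟨c, i⟩ <;> rcases q with ⟨d, k'⟩ | d | ⟨d, j⟩ <;>
      simp only [PowerAdj] at h
    · subst h; exact hy2 (d, c) k
    · subst h; exact hy1 (c, j)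
    · subst h; exact (hy2 (c, d) k').symm
    · subst h; exact (hy1 (d, i)).symm
  · rw [← hu]
    exact hclash p q hpq

/-- A uniform function composed with an injection is uniform. The bijection swaps the values of `f`
along `e` with `g`. -/
theorem card_filter_comp_mul {τ κ P : Type} [Fintype τ] [DecidableEq τ] [Fintype κ] [DecidableEq κ]
    [Fintype P] (e : τ → κ) (he : Injective e) (E : (τ → P) → Prop) :
    #{f : κ → P | E (f ∘ e)} * Fintype.card P ^ Fintype.card τ
      = #{g | E g} * Fintype.card P ^ Fintype.card κ := by
  have h1 : #{f : κ → P | E (f ∘ e)} * Fintype.card P ^ Fintype.card τ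
      = #{x : (κ → P) × (τ → P) | E (x.1 ∘ e)} := by
    have : ({x : (κ → P) × (τ → P) | E (x.1 ∘ e)} : Finset _)
        = ({f : κ → P | E (f ∘ e)} : Finset _) ×ˢ univ := by ext; simp
    rw [this, card_product]; simp
  have h2 : #{g | E g} * Fintype.card P ^ Fintype.card κ
      = #{x : (κ → P) × (τ → P) | E x.2} := by
    have : ({x : (κ → P) × (τ → P) | E x.2} : Finset _)
        = univ ×ˢ ({g | E g} : Finset _) := by ext; simp
    rw [this, card_product, mul_comm]; simp
  have hext : ∀ (f : κ → P) (g : τ → P), extend e (f ∘ e) (extend e g f) = f := by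
    intro f g
    funext c
    by_cases hc : ∃ a, e a = c
    · obtain ⟨a, rfl⟩ := hc
      rw [he.extend_apply]; rfl
    · rw [extend_apply' _ _ _ hc, extend_apply' _ _ _ hc]
  rw [h1, h2]
  refine card_nbij' (fun x => (extend e x.2 x.1, x.1 ∘ e)) (fun x => (extend e x.2 x.1, x.1 ∘ e))
    ?_ ?_ ?_ ?_
  · intro x hx
    simpa using hx
  · intro x hx
    simpa [extend_comp he] using hx
  · intro x _
    simp [hext, extend_comp he]
  · intro x _
    simp [hext, extend_comp he]

/-- The light tuples with all entries in `P`. -/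
noncomputable def lightTuples {α β : Type} [Fintype α] [Fintype β] (G : SimpleGraph (α ⊕ β))
    (t L : ℕ) (P : Finset α) : Finset (α × (Fin t → α)) :=
  {g | g.1 ∈ P ∧ (∀ j, g.2 j ∈ P) ∧ Light G L g.1 g.2}

/-- Without an induced `F^ℓ_{r,t}`, a positive proportion of the tuples in any large set is light. -/
theorem exists_card_lightTuples_ge (s r t ℓ : ℕ) (hs : 1 ≤ s) :
    ∃ (L m : ℕ) (c : ℝ), 0 < c ∧ ∀ (α β : Type) [Fintype α] [Fintype β] (G : SimpleGraph (α ⊕ β)),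
      (completeBipartiteGraph (Fin s) (Fin s)).Free G → ¬ HasPower G r t ℓ →
      ∀ P : Finset α, m ≤ #P → c * (#P : ℝ) ^ (t + 1) ≤ #(lightTuples G t L P) := by
  obtain ⟨L, hL⟩ := exists_light_of_large s r t ℓ hs
  -- A random `L`-tuple in `P` repeats an entry with probability at most `L^2 / #P ≤ 1/2`. Otherwise
  -- one of at most `L^(t+1)` injective choices of `t + 1` positions gives a light tuple. The last
  -- `+ 1` avoids division by zero when `L = 0`.
  refine ⟨L, 2 * L ^ 2 + 1, 1 / (2 * (L ^ (t + 1) + 1)), by positivity, ?_⟩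
  intro α β _ _ G hfree hpow P hP
  have hP0 : 0 < Fintype.card P := by rw [Fintype.card_coe]; omega
  have hPr : (2 * L ^ 2 + 1 : ℝ) ≤ Fintype.card P := by
    rw [Fintype.card_coe]; exact_mod_cast hP
  have hP0r : (0 : ℝ) < Fintype.card P := by exact_mod_cast hP0
  let E : (Fin (t + 1) → P) → Prop := fun g => Light G L (g 0).1 (fun j : Fin t => (g j.succ).1)
  have hE : #{g | E g} ≤ #(lightTuples G t L P) := by
    refine card_le_card_of_injOn (fun g => ((g 0).1, fun j : Fin t => (g j.succ).1)) ?_ ?_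
    · intro g hg
      simp only [coe_filter, Set.mem_ofPred_eq, mem_univ, true_and] at hg
      simp only [lightTuples, coe_filter, Set.mem_ofPred_eq, mem_univ, true_and]
      exact ⟨(g 0).2, fun j => (g j.succ).2, hg⟩
    · intro g _ g' _ h
      simp only [Prod.mk.injEq] at h
      funext j
      refine Fin.cases (Subtype.ext h.1) (fun j => Subtype.ext (congrFun h.2 j)) j
  have hcover : (univ : Finset (Fin L → P)) ⊆ ({f | ¬ Injective f} : Finset _) ∪
      ({e : Fin (t + 1) → Fin L | Injective e} : Finset _).biUnion
        fun e => ({f : Fin L → P | E (f ∘ e)} : Finset _) := by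
    intro f _
    by_cases hf : Injective f
    · refine mem_union_right _ ?_
      obtain ⟨z, hz, x, hx, hlight⟩ := hL α β G hfree hpow (univ.image fun i => (f i).1) (by
        rw [card_image_of_injective (f := fun i => (f i).1) _ (Subtype.val_injective.comp hf)]; simp)
      simp only [mem_image, mem_univ, true_and] at hz hx
      obtain ⟨a, rfl⟩ := hz
      choose b hb using hx
      obtain rfl : (fun j => (f (b j)).1) = x := funext hb
      simp only [mem_biUnion, mem_filter, mem_univ, true_and]
      refine ⟨Fin.cons a b, ?_, hlight⟩
      rw [Fin.cons_injective_iff]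
      refine ⟨?_, ?_⟩
      · rintro ⟨j, rfl⟩
        exact hlight.2.1 j (Or.inl rfl)
      · intro j k hjk
        by_contra hne
        exact hlight.2.2 j k hne (Or.inl (by simp only [hjk]))
    · exact mem_union_left _ (by simpa using hf)
  have h1 := (card_le_card hcover).trans ((card_union_le _ _).trans
    (Nat.add_le_add_left card_biUnion_le _))
  have h2 : (#{f : Fin L → P | ¬ Injective f} : ℝ)
      ≤ L ^ 2 * (Fintype.card P : ℝ)⁻¹ * Fintype.card P ^ L := by
    refine le_trans (le_of_eq ?_) (card_not_injective_le (δ := P) L hP0)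
    congr!
  set p : ℝ := (Fintype.card P : ℝ) with hp
  have h3 : ∀ e ∈ ({e : Fin (t + 1) → Fin L | Injective e} : Finset _),
      (#{f : Fin L → P | E (f ∘ e)} : ℝ) = #{g | E g} * p ^ L / p ^ (t + 1) := by
    intro e he
    have he : Injective e := by simpa using he
    have := card_filter_comp_mul e he E
    rw [Fintype.card_fin, Fintype.card_fin] at this
    rw [eq_div_iff (by positivity), hp]
    exact_mod_cast this
  have h4 : p ^ L ≤ L ^ 2 * p⁻¹ * p ^ L + L ^ (t + 1) * (#{g | E g} * p ^ L / p ^ (t + 1)) := by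
    have h5 : p ^ L ≤ (#{f : Fin L → P | ¬ Injective f} : ℝ) +
        ∑ e ∈ ({e : Fin (t + 1) → Fin L | Injective e} : Finset _),
          (#{f : Fin L → P | E (f ∘ e)} : ℝ) := by
      rw [card_univ, Fintype.card_fun, Fintype.card_fin] at h1
      rw [hp]; exact_mod_cast h1
    refine h5.trans (add_le_add h2 ?_)
    rw [sum_congr rfl h3, sum_const, nsmul_eq_mul]
    refine mul_le_mul_of_nonneg_right ?_ (by positivity)
    have : #({e : Fin (t + 1) → Fin L | Injective e} : Finset _) ≤ L ^ (t + 1) :=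
      (card_le_univ _).trans (by simp)
    exact_mod_cast this
  have h6 : (L : ℝ) ^ 2 * p⁻¹ ≤ 1 / 2 := by
    rw [← div_eq_mul_inv, div_le_iff₀ hP0r]; linarith
  have hpL : 0 < p ^ L := by positivity
  have h7 : p ^ L * (1 / 2) ≤ p ^ L * (L ^ (t + 1) * (#{g | E g} / p ^ (t + 1))) := by
    have e1 : L ^ (t + 1) * (#{g | E g} * p ^ L / p ^ (t + 1))
      = p ^ L * (L ^ (t + 1) * (#{g | E g} / p ^ (t + 1))) := by ring
    have e2 : (L : ℝ) ^ 2 * p⁻¹ * p ^ L ≤ 1 / 2 * p ^ L := mul_le_mul_of_nonneg_right h6 hpL.le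
    linarith
  have h8 := le_of_mul_le_mul_left h7 hpL
  have h9 : p ^ (t + 1) ≤ 2 * L ^ (t + 1) * #{g | E g} := by
    rw [← mul_div_assoc, le_div_iff₀ (by positivity)] at h8
    linarith
  have h10 : (#{g | E g} : ℝ) ≤ #(lightTuples G t L P) := by exact_mod_cast hE
  rw [one_div, inv_mul_le_iff₀ (by positivity)]
  have h11 : (#P : ℝ) = p := by rw [hp, Fintype.card_coe]
  rw [h11]
  nlinarith [h9, h10, pow_nonneg (Nat.cast_nonneg (α := ℝ) L) (t + 1)]

/-! ### Almost regular graphs and the number of good copies -/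

/-- The neighbours in `α` of a vertex of `β`. -/
noncomputable def nbrsL {α β : Type} [Fintype α] (G : SimpleGraph (α ⊕ β)) (b : β) : Finset α :=
  {a | G.Adj (.inl a) (.inr b)}

/-- The neighbours in `β` of a vertex of `α`. -/
noncomputable def nbrsR {α β : Type} [Fintype β] (G : SimpleGraph (α ⊕ β)) (a : α) : Finset β :=
  {b | G.Adj (.inl a) (.inr b)}

/-- Almost regularity of the edges between `α` and `β`: the parts have at most `n` vertices, the
degrees are at most `Δ`, and there are at least `n * Δ / K` edges. -/
structure AlmostRegular {α β : Type} [Fintype α] [Fintype β] (G : SimpleGraph (α ⊕ β))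
    (n Δ K : ℕ) : Prop where
  card_left : Fintype.card α ≤ n
  card_right : Fintype.card β ≤ n
  nbrsL_le : ∀ b, #(nbrsL G b) ≤ Δ
  nbrsR_le : ∀ a, #(nbrsR G a) ≤ Δ
  edges_ge : n * Δ ≤ K * ∑ b, #(nbrsL G b)

theorem sum_nbrsL_eq {α β : Type} [Fintype α] [Fintype β] (G : SimpleGraph (α ⊕ β)) :
    ∑ b, #(nbrsL G b) = ∑ a, #(nbrsR G a) := by
  simp only [nbrsL, nbrsR, card_filter]
  exact sum_comm

/-- The pairs of a neighbour `y` of `z` and a `t`-tuple of neighbours of `y`. -/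
noncomputable def branches {α β : Type} [Fintype α] [Fintype β] (G : SimpleGraph (α ⊕ β)) (t : ℕ)
    (z : α) : Finset (β × (Fin t → α)) :=
  {w | G.Adj (.inl z) (.inr w.1) ∧ ∀ j, G.Adj (.inl (w.2 j)) (.inr w.1)}

theorem card_branches_le {α β : Type} [Fintype α] [Fintype β] {G : SimpleGraph (α ⊕ β)}
    {n Δ K : ℕ} (hG : AlmostRegular G n Δ K) (t : ℕ) (z : α) :
    #(branches G t z) ≤ Δ ^ (t + 1) := by
  have h : branches G t z ⊆ (nbrsR G z).biUnion
      fun y => ({y} : Finset β) ×ˢ Fintype.piFinset fun _ : Fin t => nbrsL G y := by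
    intro w hw
    simp only [branches, mem_filter, mem_univ, true_and] at hw
    simp only [mem_biUnion, mem_product, mem_singleton, Fintype.mem_piFinset, nbrsR, nbrsL,
      mem_filter, mem_univ, true_and]
    exact ⟨w.1, hw.1, rfl, hw.2⟩
  refine (card_le_card h).trans (card_biUnion_le.trans ?_)
  calc ∑ y ∈ nbrsR G z, #(({y} : Finset β) ×ˢ Fintype.piFinset fun _ : Fin t => nbrsL G y)
      ≤ ∑ _y ∈ nbrsR G z, Δ ^ t := by
        refine sum_le_sum fun y _ => ?_
        simp only [card_product, card_singleton, one_mul, Fintype.card_piFinset, prod_const,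
          card_univ, Fintype.card_fin]
        exact Nat.pow_le_pow_left (hG.nbrsL_le y) t
    _ ≤ Δ * Δ ^ t := by
        rw [sum_const, smul_eq_mul]
        exact Nat.mul_le_mul_right _ (hG.nbrsR_le z)
    _ = Δ ^ (t + 1) := by ring

/-- A centre together with `r` branches. -/
abbrev TreeCopy (α β : Type) (r t : ℕ) : Type := α × (Fin r → β × (Fin t → α))

/-- The branch to which a vertex belongs. -/
def branchOf {r t : ℕ} : Fin r ⊕ Fin r × Fin t → Fin r := Sum.elim id Prod.fst

/-- The middle vertices and the leaves of a family of branches. -/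
def branchVertex {α β : Type} {r t : ℕ} (w : Fin r → β × (Fin t → α)) :
    Fin r ⊕ Fin r × Fin t → α ⊕ β :=
  Sum.elim (fun i => .inr (w i).1) (fun p => .inl ((w p.1).2 p.2))

/-- The branches at `z` that form a light tuple with `z`. -/
noncomputable def lightBranches {α β : Type} [Fintype α] [Fintype β] (G : SimpleGraph (α ⊕ β))
    (t L : ℕ) (z : α) : Finset (β × (Fin t → α)) :=
  {w ∈ branches G t z | Light G L z w.2}

/-- The induced copies of `T_{r,t}` all of whose branches are light. -/
noncomputable def goodCopies {α β : Type} [Fintype α] [Fintype β] (G : SimpleGraph (α ⊕ β))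
    (r t L : ℕ) : Finset (TreeCopy α β r t) :=
  {T | (∀ i, T.2 i ∈ lightBranches G t L T.1) ∧
    ∀ p q, branchOf p ≠ branchOf q → ¬ Clash G (branchVertex T.2 p) (branchVertex T.2 q)}

theorem exists_injective_range_superset {N : ℕ} {β : Type} [Fintype β] (Q : Finset β) (hQ : #Q ≤ N)
    (hN : N ≤ Fintype.card β) : ∃ f : Fin N → β, Injective f ∧ ∀ q ∈ Q, ∃ k, f k = q := by
  obtain ⟨R, hQR, -, hR⟩ := exists_subsuperset_card_eq (subset_univ Q) hQ (by rwa [card_univ])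
  refine ⟨fun k => ((R.equivFinOfCardEq hR).symm k).1, ?_, ?_⟩
  · exact fun k k' hk => (R.equivFinOfCardEq hR).symm.injective (Subtype.ext hk)
  · intro q hq
    exact ⟨R.equivFinOfCardEq hR ⟨q, hQR hq⟩, by simp⟩

/-- Few families of branches have a clash between two different branches. -/
theorem card_clashing_le {α β : Type} [Fintype α] [Fintype β] {G : SimpleGraph (α ⊕ β)}
    {n Δ K : ℕ} (hG : AlmostRegular G n Δ K) (r t : ℕ) {η : ℝ} (hη : 0 ≤ η) {N₀ : ℕ}
    (hN : ∀ (γ δ : Type) [Fintype γ] [Fintype δ] (f : γ → α ⊕ β) (g : δ → α ⊕ β),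
        Injective f → Injective g → N₀ ≤ Fintype.card γ → N₀ ≤ Fintype.card δ →
        (#{p : γ × δ | Clash G (f p.1) (g p.2)} : ℝ) ≤ η * Fintype.card γ * Fintype.card δ)
    (hΔ : N₀ ≤ Δ) (hα : Δ ≤ Fintype.card α) (hβ : Δ ≤ Fintype.card β) (z : α) :
    (#{w : Fin r → β × (Fin t → α) | (∀ i, w i ∈ branches G t z) ∧
      ∃ p q, branchOf p ≠ branchOf q ∧ Clash G (branchVertex w p) (branchVertex w q)} : ℝ)
      ≤ (r * (t + 1)) ^ 2 * η * Δ ^ (r * (t + 1)) := by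
  -- Neighbourhoods are padded to exactly `Δ` vertices. Every family of branches at `z` is then `dec
  -- ω` for one of `Δ^(r(t+1))` choices of `ω`, each coordinate has enough values for the clash
  -- bound, and different branches use disjoint sets of coordinates.
  choose νL hνLinj hνL using fun b => exists_injective_range_superset (nbrsL G b) (hG.nbrsL_le b) hα
  choose νR hνRinj hνR using fun a => exists_injective_range_superset (nbrsR G a) (hG.nbrsR_le a) hβ
  set κ := Fin r ⊕ Fin r × Fin t
  have hκ : Fintype.card κ = r * (t + 1) := by
    simp only [κ, Fintype.card_sum, Fintype.card_prod, Fintype.card_fin]; ring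
  let dec : (κ → Fin Δ) → Fin r → β × (Fin t → α) := fun ω i =>
    (νR z (ω (.inl i)), fun j => νL (νR z (ω (.inl i))) (ω (.inr (i, j))))
  have hindep : ∀ p q, branchOf p ≠ branchOf q → ∀ ω b,
      branchVertex (dec (update ω q b)) p = branchVertex (dec ω) p := by
    rintro (p | ⟨p, j⟩) q hpq ω b
    · have h1 : Sum.inl p ≠ q := by rintro rfl; exact hpq rfl
      simp only [branchVertex, dec, Sum.elim_inl, update_of_ne h1]
    · have h1 : Sum.inl p ≠ q := by rintro rfl; exact hpq rfl
      have h2 : Sum.inr (p, j) ≠ q := by rintro rfl; exact hpq rfl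
      simp only [branchVertex, dec, Sum.elim_inr, update_of_ne h1, update_of_ne h2]
  have hinj : ∀ p ω, Injective fun a => branchVertex (dec (update ω p a)) p := by
    rintro (p | ⟨p, j⟩) ω a b hab
    · simp only [branchVertex, dec, Sum.elim_inl, update_self] at hab
      exact hνRinj _ (Sum.inr_injective hab)
    · have h1 : (Sum.inl p : κ) ≠ Sum.inr (p, j) := by simp
      simp only [branchVertex, dec, Sum.elim_inr, update_self, update_of_ne h1] at hab
      exact hνLinj _ (Sum.inl_injective hab)
  have hsub : ({w : Fin r → β × (Fin t → α) | (∀ i, w i ∈ branches G t z) ∧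
      ∃ p q, branchOf p ≠ branchOf q ∧ Clash G (branchVertex w p) (branchVertex w q)} : Finset _) ⊆
      (univ : Finset (κ × κ)).biUnion fun pq => ({ω : κ → Fin Δ | branchOf pq.1 ≠ branchOf pq.2 ∧
        Clash G (branchVertex (dec ω) pq.1) (branchVertex (dec ω) pq.2)} : Finset _).image dec := by
    intro w hw
    simp only [mem_filter, mem_univ, true_and] at hw
    obtain ⟨hw, p, q, hpq, hc⟩ := hw
    have h1 : ∀ i, ∃ k, νR z k = (w i).1 := fun i => hνR z _ (by
      have := hw i
      simp only [branches, nbrsR, mem_filter, mem_univ, true_and] at this ⊢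
      exact this.1)
    have h2 : ∀ i j, ∃ k, νL (w i).1 k = (w i).2 j := fun i j => hνL _ _ (by
      have := hw i
      simp only [branches, nbrsL, mem_filter, mem_univ, true_and] at this ⊢
      exact this.2 j)
    choose k1 hk1 using h1
    choose k2 hk2 using h2
    have hdec : dec (Sum.elim k1 fun p => k2 p.1 p.2) = w := by
      funext i
      simp only [dec, Sum.elim_inl, Sum.elim_inr, hk1, hk2]
    simp only [mem_biUnion, mem_image, mem_filter, mem_univ, true_and]
    exact ⟨(p, q), _, ⟨hpq, by rw [hdec]; exact hc⟩, hdec⟩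
  have hcard := (card_le_card hsub).trans (card_biUnion_le.trans
    (sum_le_sum fun _ _ => card_image_le))
  have hpair : ∀ pq : κ × κ, (#{ω : κ → Fin Δ | branchOf pq.1 ≠ branchOf pq.2 ∧
        Clash G (branchVertex (dec ω) pq.1) (branchVertex (dec ω) pq.2)} : ℝ)
        ≤ η * Δ ^ (r * (t + 1)) := by
    rintro ⟨p, q⟩
    by_cases hpq : branchOf p ≠ branchOf q
    · have := clash_fraction_le (Ω := fun _ : κ => Fin Δ) hN (fun ω => branchVertex (dec ω) p)
        (fun ω => branchVertex (dec ω) q) p q (fun h => hpq (by rw [h])) (hinj p) (hinj q)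
        (hindep p q hpq) (hindep q p hpq.symm) (by simpa using hΔ) (by simpa using hΔ)
      rw [Fintype.card_fun, Fintype.card_fin, hκ] at this
      push_cast at this
      refine le_trans ?_ this
      gcongr
      exact fun h => h.2
    · have : ∀ ω : κ → Fin Δ, ¬ (branchOf p ≠ branchOf q ∧
        Clash G (branchVertex (dec ω) p) (branchVertex (dec ω) q)) := by tauto
      simp only [this]
      simp
      positivity
  refine le_trans (by exact_mod_cast hcard) ((sum_le_sum fun pq _ => hpair pq).trans ?_)
  rw [sum_const, card_univ, Fintype.card_prod, hκ, nsmul_eq_mul]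
  push_cast
  exact le_of_eq (by ring)

/-- Room for padding neighbourhoods to size `Δ`. Degree counting gives `Δ ≤ Kn` and sides of size at
least `n/K`, so both sides are large. Sparsity then bounds the edges by `|α||β|/K²`, whence `nΔ ≤
|α||β|`, and each side has at most `n` vertices. -/
theorem AlmostRegular.le_card {α β : Type} [Fintype α] [Fintype β] {G : SimpleGraph (α ⊕ β)}
    {n Δ K : ℕ} (hG : AlmostRegular G n Δ K) (hn : 0 < n) (hK : 0 < K) {N₀ : ℕ}
    (hN : ∀ (γ δ : Type) [Fintype γ] [Fintype δ] (f : γ → α ⊕ β) (g : δ → α ⊕ β),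
        Injective f → Injective g → N₀ ≤ Fintype.card γ → N₀ ≤ Fintype.card δ →
        (#{p : γ × δ | Clash G (f p.1) (g p.2)} : ℝ)
          ≤ 1 / K ^ 2 * Fintype.card γ * Fintype.card δ)
    (hΔ : K ^ 2 * N₀ + 1 ≤ Δ) : Δ ≤ Fintype.card α ∧ Δ ≤ Fintype.card β := by
  have hsq : ∑ b, #(nbrsL G b) ≤ Fintype.card β * Fintype.card α := by
    refine (sum_le_card_nsmul _ _ _ fun b _ => card_le_univ _).trans ?_
    simp
  have he := hG.edges_ge
  have hα := hG.card_left
  have hβ := hG.card_right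
  have hΔ0 : 0 < Δ := by omega
  have h1 : Δ ≤ K * n := by
    have : n * Δ ≤ n * (K * n) := by
      calc n * Δ ≤ K * (Fintype.card β * Fintype.card α) := he.trans (Nat.mul_le_mul_left _ hsq)
        _ ≤ K * (n * n) := by gcongr
        _ = n * (K * n) := by ring
    exact Nat.le_of_mul_le_mul_left this hn
  have h2 : n ≤ K * Fintype.card β := by
    have : ∑ b, #(nbrsL G b) ≤ Fintype.card β * Δ := by
      refine (sum_le_card_nsmul _ _ _ fun b _ => hG.nbrsL_le b).trans ?_
      simp
    have : n * Δ ≤ K * Fintype.card β * Δ := by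
      rw [mul_assoc]; exact he.trans (Nat.mul_le_mul_left _ this)
    exact Nat.le_of_mul_le_mul_right this hΔ0
  have h3 : n ≤ K * Fintype.card α := by
    have : ∑ b, #(nbrsL G b) ≤ Fintype.card α * Δ := by
      rw [sum_nbrsL_eq]
      refine (sum_le_card_nsmul _ _ _ fun b _ => hG.nbrsR_le b).trans ?_
      simp
    have : n * Δ ≤ K * Fintype.card α * Δ := by
      rw [mul_assoc]; exact he.trans (Nat.mul_le_mul_left _ this)
    exact Nat.le_of_mul_le_mul_right this hΔ0
  have h4 : N₀ ≤ Fintype.card α := by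
    have : K ^ 2 * N₀ ≤ K ^ 2 * Fintype.card α := by
      calc K ^ 2 * N₀ ≤ K * n := by omega
        _ ≤ K * (K * Fintype.card α) := by gcongr
        _ = _ := by ring
    exact Nat.le_of_mul_le_mul_left this (by positivity)
  have h5 : N₀ ≤ Fintype.card β := by
    have : K ^ 2 * N₀ ≤ K ^ 2 * Fintype.card β := by
      calc K ^ 2 * N₀ ≤ K * n := by omega
        _ ≤ K * (K * Fintype.card β) := by gcongr
        _ = _ := by ring
    exact Nat.le_of_mul_le_mul_left this (by positivity)
  have h6 := hN α β Sum.inl Sum.inr Sum.inl_injective Sum.inr_injective h4 h5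
  have h7 : ∑ b, #(nbrsL G b) ≤ #{p : α × β | Clash G (.inl p.1) (.inr p.2)} := by
    rw [card_filter, Fintype.sum_prod_type_right]
    refine sum_le_sum fun b _ => ?_
    rw [← card_filter, nbrsL]
    gcongr
    exact Or.inr
  have hKr : (0 : ℝ) < K := by exact_mod_cast hK
  have hnr : (0 : ℝ) < n := by exact_mod_cast hn
  have h8 : (K : ℝ) ^ 2 * ∑ b, (#(nbrsL G b) : ℝ) ≤ Fintype.card α * Fintype.card β := by
    have : (∑ b, (#(nbrsL G b) : ℝ)) ≤ 1 / K ^ 2 * Fintype.card α * Fintype.card β :=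
      le_trans (by exact_mod_cast h7) h6
    rw [mul_assoc, one_div, le_inv_mul_iff₀ (by positivity)] at this
    exact this
  have h9 : K ^ 2 * ∑ b, #(nbrsL G b) ≤ Fintype.card α * Fintype.card β := by exact_mod_cast h8
  have h10 : n * Δ ≤ Fintype.card α * Fintype.card β := by
    refine he.trans (le_trans ?_ h9)
    exact Nat.mul_le_mul_right _ (by nlinarith)
  constructor
  · refine le_of_mul_le_mul_left (a := n) ?_ hn
    refine h10.trans ?_
    rw [mul_comm]; gcongr
  · refine le_of_mul_le_mul_left (a := n) ?_ hn
    refine h10.trans ?_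
    gcongr

theorem sum_card_lightBranches_eq {α β : Type} [Fintype α] [Fintype β] (G : SimpleGraph (α ⊕ β))
    (t L : ℕ) : ∑ z, #(lightBranches G t L z) = ∑ b, #(lightTuples G t L (nbrsL G b)) := by
  simp only [lightBranches, branches, lightTuples, filter_filter, card_filter,
    Fintype.sum_prod_type, nbrsL, mem_filter, mem_univ, true_and]
  rw [sum_comm]
  refine sum_congr rfl fun b _ => sum_congr rfl fun z _ => sum_congr rfl fun x _ => ?_
  simp only [and_assoc]

/-- Light branches are counted from their middle vertex `y`, as light tuples in its neighbourhood.
Vertices with fewer than `m` neighbours carry at most `nm` edges, half of the guaranteed number once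
`Δ ≥ 2Km`; convexity handles the rest. -/
theorem exists_sum_lightBranches_ge (t m K : ℕ) (hK : 0 < K) (c : ℝ) (hc : 0 < c) :
    ∃ (c' : ℝ) (D : ℕ), 0 < c' ∧ ∀ (α β : Type) [Fintype α] [Fintype β] (G : SimpleGraph (α ⊕ β))
      (n Δ L : ℕ), AlmostRegular G n Δ K →
      (∀ P : Finset α, m ≤ #P → c * (#P : ℝ) ^ (t + 1) ≤ #(lightTuples G t L P)) → D ≤ Δ →
      c' * n * Δ ^ (t + 1) ≤ ∑ z, (#(lightBranches G t L z) : ℝ) := by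
  have hKr : (0 : ℝ) < K := by exact_mod_cast hK
  refine ⟨c / (2 * K) ^ (t + 1), 2 * K * m, by positivity, ?_⟩
  intro α β _ _ G n Δ L hG hlight hD
  have hDr : (2 * K * m : ℝ) ≤ Δ := by exact_mod_cast hD
  have hsum : ∑ z, (#(lightBranches G t L z) : ℝ) = ∑ b, (#(lightTuples G t L (nbrsL G b)) : ℝ) := by
    exact_mod_cast sum_card_lightBranches_eq G t L
  rcases Nat.eq_zero_or_pos n with rfl | hn
  · simp; positivity
  have hnr : (0 : ℝ) < n := by exact_mod_cast hn
  rw [hsum]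
  set B : Finset β := {b | m ≤ #(nbrsL G b)} with hB
  have h1 : (n * Δ : ℝ) ≤ K * ∑ b, (#(nbrsL G b) : ℝ) := by exact_mod_cast hG.edges_ge
  have h2 : ∑ b, (#(nbrsL G b) : ℝ) ≤ ∑ b ∈ B, (#(nbrsL G b) : ℝ) + n * m := by
    rw [← sum_filter_add_sum_filter_not univ (fun b => m ≤ #(nbrsL G b))]
    refine add_le_add le_rfl ?_
    refine (sum_le_card_nsmul _ _ (m : ℝ) ?_).trans ?_
    · intro b hb
      simp only [mem_filter, mem_univ, true_and, not_le] at hb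
      exact_mod_cast hb.le
    · rw [nsmul_eq_mul]
      gcongr
      exact_mod_cast (card_le_univ _).trans hG.card_right
  have h3 : (n * Δ : ℝ) / (2 * K) ≤ ∑ b ∈ B, (#(nbrsL G b) : ℝ) := by
    rw [div_le_iff₀ (by positivity)]
    nlinarith [mul_le_mul_of_nonneg_left h2 hKr.le]
  have h4 := pow_sum_le_mul_sum_pow B (fun b => (#(nbrsL G b) : ℝ)) (fun _ _ => by positivity) t n
    (by exact_mod_cast (card_le_univ _).trans hG.card_right)
  have h5 : c * ∑ b ∈ B, (#(nbrsL G b) : ℝ) ^ (t + 1)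
      ≤ ∑ b, (#(lightTuples G t L (nbrsL G b)) : ℝ) := by
    rw [mul_sum]
    refine (sum_le_sum fun b hb => hlight _ (by simpa [hB] using hb)).trans ?_
    exact sum_le_sum_of_subset_of_nonneg (subset_univ _) fun _ _ _ => by positivity
  refine le_trans ?_ h5
  have h6 : ((n * Δ : ℝ) / (2 * K)) ^ (t + 1)
      ≤ n ^ t * ∑ b ∈ B, (#(nbrsL G b) : ℝ) ^ (t + 1) :=
    (pow_le_pow_left₀ (by positivity) h3 _).trans h4
  have h7 : ((n * Δ : ℝ) / (2 * K)) ^ (t + 1)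
      = n ^ t * (n * Δ ^ (t + 1) / (2 * K) ^ (t + 1)) := by
    rw [div_pow, mul_pow]; ring
  rw [h7] at h6
  have h8 := le_of_mul_le_mul_left h6 (by positivity)
  calc c / (2 * K) ^ (t + 1) * n * Δ ^ (t + 1) = c * (n * Δ ^ (t + 1) / (2 * K) ^ (t + 1)) := by ring
    _ ≤ _ := mul_le_mul_of_nonneg_left h8 hc.le

/-- A positive proportion of all copies of `T_{r,t}` is good. -/
theorem exists_card_goodCopies_ge (s r t m K : ℕ) (hs : 1 ≤ s) (hr : 1 ≤ r) (hK : 0 < K) (c : ℝ)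
    (hc : 0 < c) :
    ∃ (c' : ℝ) (D : ℕ), 0 < c' ∧ ∀ (α β : Type) [Fintype α] [Fintype β] (G : SimpleGraph (α ⊕ β))
      (n Δ L : ℕ), AlmostRegular G n Δ K → (completeBipartiteGraph (Fin s) (Fin s)).Free G →
      (∀ P : Finset α, m ≤ #P → c * (#P : ℝ) ^ (t + 1) ≤ #(lightTuples G t L P)) → D ≤ Δ →
      c' * n * Δ ^ (r * (t + 1)) ≤ #(goodCopies G r t L) := by
  obtain ⟨c₁, D₁, hc₁, h₁⟩ := exists_sum_lightBranches_ge t m K hK c hc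
  -- Families with a clash may then destroy at most half of the `c₁^r n Δ^(r(t+1))` families of
  -- light branches that convexity provides.
  set η : ℝ := c₁ ^ r / (2 * (r * (t + 1)) ^ 2) with hη
  have hr0 : (0 : ℝ) < r := by exact_mod_cast hr
  have hKr : (0 : ℝ) < K := by exact_mod_cast hK
  have hη0 : 0 < η := by positivity
  obtain ⟨N₁, hN₁0, hN₁⟩ := exists_clash_bound s hs η hη0
  obtain ⟨N₂, hN₂0, hN₂⟩ := exists_clash_bound s hs (1 / K ^ 2) (by positivity)
  refine ⟨c₁ ^ r / 2, D₁ + N₁ + (K ^ 2 * N₂ + 1), by positivity, ?_⟩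
  intro α β _ _ G n Δ L hG hfree hlight hD
  rcases Nat.eq_zero_or_pos n with rfl | hn
  · simp
  have hnr : (0 : ℝ) < n := by exact_mod_cast hn
  obtain ⟨hα, hβ⟩ := hG.le_card hn hK (hN₂ _ G hfree) (by omega)
  have hsum := h₁ α β G n Δ L hG hlight (by omega)
  obtain ⟨r', rfl⟩ : ∃ r', r = r' + 1 := ⟨r - 1, by omega⟩
  have hpow := pow_sum_le_mul_sum_pow (univ : Finset α) (fun z => (#(lightBranches G t L z) : ℝ))
    (fun _ _ => by positivity) r' n (by rw [card_univ]; exact_mod_cast hG.card_left)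
  have hlow : c₁ ^ (r' + 1) * n * Δ ^ ((r' + 1) * (t + 1))
      ≤ ∑ z, (#(lightBranches G t L z) : ℝ) ^ (r' + 1) := by
    have h2 := (pow_le_pow_left₀ (by positivity) hsum (r' + 1)).trans hpow
    have h3 : (c₁ * n * Δ ^ (t + 1)) ^ (r' + 1)
        = n ^ r' * (c₁ ^ (r' + 1) * n * Δ ^ ((r' + 1) * (t + 1))) := by
      rw [mul_pow, mul_pow, ← pow_mul, mul_comm (t + 1) (r' + 1)]; ring
    rw [h3] at h2
    exact le_of_mul_le_mul_left h2 (by positivity)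
  have hsplit : ∀ z, #(lightBranches G t L z) ^ (r' + 1)
      ≤ #{w : Fin (r' + 1) → β × (Fin t → α) | (z, w) ∈ goodCopies G (r' + 1) t L} +
        #{w : Fin (r' + 1) → β × (Fin t → α) | (∀ i, w i ∈ branches G t z) ∧
      ∃ p q, branchOf p ≠ branchOf q ∧ Clash G (branchVertex w p) (branchVertex w q)} := by
    intro z
    have h4 : #(Fintype.piFinset fun _ : Fin (r' + 1) => lightBranches G t L z)
        = #(lightBranches G t L z) ^ (r' + 1) := by simp
    rw [← h4]
    refine (card_le_card ?_).trans (card_union_le _ _)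
    intro w hw
    rw [Fintype.mem_piFinset] at hw
    rw [mem_union, mem_filter, mem_filter, goodCopies, mem_filter]
    by_cases hcl : ∃ p q, branchOf p ≠ branchOf q ∧ Clash G (branchVertex w p) (branchVertex w q)
    · exact Or.inr ⟨mem_univ _, fun i => (mem_filter.1 (hw i)).1, hcl⟩
    · push Not at hcl
      exact Or.inl ⟨mem_univ _, mem_univ _, hw, hcl⟩
  have hgood : #(goodCopies G (r' + 1) t L)
      = ∑ z, #{w : Fin (r' + 1) → β × (Fin t → α) | (z, w) ∈ goodCopies G (r' + 1) t L} := by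
    have h5 : goodCopies G (r' + 1) t L = ({T | T ∈ goodCopies G (r' + 1) t L} : Finset _) := by
      ext; simp
    conv_lhs => rw [h5, card_filter, Fintype.sum_prod_type]
    refine sum_congr rfl fun z _ => ?_
    rw [card_filter]
  have hbad : ∀ z, _ := card_clashing_le hG (r' + 1) t hη0.le (hN₁ _ G hfree) (by omega) hα hβ
  have hfin : ∑ z, (#(lightBranches G t L z) : ℝ) ^ (r' + 1) ≤ #(goodCopies G (r' + 1) t L)
      + n * (((r' + 1 : ℕ) * (t + 1)) ^ 2 * η * Δ ^ ((r' + 1) * (t + 1))) := by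
    rw [hgood]
    push_cast
    have h6 : ∀ z, (#(lightBranches G t L z) : ℝ) ^ (r' + 1)
      ≤ #{w : Fin (r' + 1) → β × (Fin t → α) | (z, w) ∈ goodCopies G (r' + 1) t L} +
        (((r' + 1 : ℕ) * (t + 1)) ^ 2 * η * Δ ^ ((r' + 1) * (t + 1))) := fun z =>
      le_trans (by exact_mod_cast hsplit z) (add_le_add le_rfl (hbad z))
    refine (sum_le_sum fun z _ => h6 z).trans ?_
    rw [sum_add_distrib, sum_const, nsmul_eq_mul, card_univ]
    push_cast
    gcongr
    exact hG.card_left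
  have h7 : (n : ℝ) * (((r' + 1 : ℕ) * (t + 1)) ^ 2 * η * Δ ^ ((r' + 1) * (t + 1)))
      = c₁ ^ (r' + 1) / 2 * n * Δ ^ ((r' + 1) * (t + 1)) := by
    rw [hη]; field_simp
  rw [h7] at hfin
  linarith

/-! ### Sunflowers of good copies -/

/-- Two copies have different centres and disjoint sets of middle vertices outside `S`. -/
def Separate {α β : Type} {r t : ℕ} (S : Finset (Fin r)) (T T' : TreeCopy α β r t) : Prop :=
  T.1 ≠ T'.1 ∧ ∀ i ∉ S, ∀ j ∉ S, (T.2 i).1 ≠ (T'.2 j).1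

theorem Separate.symm {α β : Type} {r t : ℕ} {S : Finset (Fin r)} {T T' : TreeCopy α β r t}
    (h : Separate S T T') : Separate S T' T :=
  ⟨h.1.symm, fun i hi j hj => (h.2 j hj i hi).symm⟩

/-- There are `N` pairwise separate copies in `𝒯` with the leaves of `T` and with the middle
vertices of `T` on the branches in `S`. -/
def IsKernel {α β : Type} {r t : ℕ} (𝒯 : Finset (TreeCopy α β r t)) (S : Finset (Fin r)) (N : ℕ)
    (T : TreeCopy α β r t) : Prop :=
  ∃ 𝓕 ⊆ 𝒯, N ≤ #𝓕 ∧
    (∀ T' ∈ 𝓕, (∀ i, (T'.2 i).2 = (T.2 i).2) ∧ ∀ i ∈ S, (T'.2 i).1 = (T.2 i).1) ∧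
    (𝓕 : Set (TreeCopy α β r t)).Pairwise (Separate S)

/-- Greedy choice of a family of pairwise related elements. -/
theorem exists_pairwise_or_covering {τ : Type} (R : τ → τ → Prop) (hR : ∀ a b, R a b → R b a)
    (𝒮 : Finset τ) (N : ℕ) :
    (∃ 𝓕 ⊆ 𝒮, #𝓕 = N ∧ (𝓕 : Set τ).Pairwise R) ∨
      ∃ 𝓕 ⊆ 𝒮, #𝓕 < N ∧ ∀ T ∈ 𝒮, ∃ T' ∈ 𝓕, T = T' ∨ ¬ R T T' := by
  induction N with
  | zero => exact Or.inl ⟨∅, by simp⟩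
  | succ N ih =>
    rcases ih with ⟨𝓕, h𝓕, hc, hp⟩ | ⟨𝓕, h𝓕, hc, hp⟩
    · by_cases h : ∀ T ∈ 𝒮, ∃ T' ∈ 𝓕, T = T' ∨ ¬ R T T'
      · exact Or.inr ⟨𝓕, h𝓕, by omega, h⟩
      · push Not at h
        obtain ⟨T, hT, h⟩ := h
        have hT𝓕 : T ∉ 𝓕 := fun hmem => (h T hmem).1 rfl
        refine Or.inl ⟨insert T 𝓕, insert_subset hT h𝓕, by rw [card_insert_of_notMem hT𝓕, hc], ?_⟩
        rw [coe_insert]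
        exact hp.insert fun b hb _ => ⟨(h b hb).2, hR _ _ (h b hb).2⟩
    · exact Or.inr ⟨𝓕, h𝓕, by omega, hp⟩

/-- The size that forces a sunflower when `k` branches are not yet fixed. -/
def sunflowerBound (A B : ℕ) : ℕ → ℕ
  | 0 => A
  | k + 1 => A + B * sunflowerBound A B k

/-- Sunflower lemma for copies with common leaves. -/
theorem exists_sunflower {α β : Type} {r t : ℕ} (A N k : ℕ) :
    ∀ (𝒮 : Finset (TreeCopy α β r t)) (S : Finset (Fin r)), #Sᶜ = k →
      (∀ z, #{T ∈ 𝒮 | T.1 = z} ≤ A) →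
      (∀ T ∈ 𝒮, ∀ T' ∈ 𝒮, ∀ i ∈ S, (T.2 i).1 = (T'.2 i).1) →
      sunflowerBound (N * A) (N * (r * r)) k < #𝒮 →
      ∃ S' : Finset (Fin r), ∃ 𝓕 ⊆ 𝒮, #𝓕 = N ∧
        (∀ T ∈ 𝓕, ∀ T' ∈ 𝓕, ∀ i ∈ S', (T.2 i).1 = (T'.2 i).1) ∧
        (𝓕 : Set (TreeCopy α β r t)).Pairwise (Separate S') := by
  induction k with
  | zero =>
    intro 𝒮 S hS hA hy hlt
    rcases exists_pairwise_or_covering (Separate S) (fun _ _ h => h.symm) 𝒮 N with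
      ⟨𝓕, h𝓕, hc, hp⟩ | ⟨𝓕, h𝓕, hc, hp⟩
    · exact ⟨S, 𝓕, h𝓕, hc, fun T hT T' hT' => hy T (h𝓕 hT) T' (h𝓕 hT'), hp⟩
    · exfalso
      have hcov : 𝒮 ⊆ 𝓕.biUnion fun T' => {T ∈ 𝒮 | T.1 = T'.1} := by
        intro T hT
        obtain ⟨T', hT', h⟩ := hp T hT
        simp only [mem_biUnion, mem_filter]
        refine ⟨T', hT', hT, ?_⟩
        rcases h with rfl | h
        · rfl
        · by_contra hne
          refine h ⟨hne, fun i hi => ?_⟩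
          exact absurd (mem_compl.2 hi) (by simp [card_eq_zero.1 hS])
      have := (card_le_card hcov).trans (card_biUnion_le.trans (sum_le_sum fun T _ => hA T.1))
      simp only [sum_const, smul_eq_mul] at this
      have h2 : #𝓕 * A ≤ N * A := Nat.mul_le_mul_right _ hc.le
      simp only [sunflowerBound] at hlt
      omega
  | succ k ih =>
    intro 𝒮 S hS hA hy hlt
    rcases exists_pairwise_or_covering (Separate S) (fun _ _ h => h.symm) 𝒮 N with
      ⟨𝓕, h𝓕, hc, hp⟩ | ⟨𝓕, h𝓕, hc, hp⟩
    · exact ⟨S, 𝓕, h𝓕, hc, fun T hT T' hT' => hy T (h𝓕 hT) T' (h𝓕 hT'), hp⟩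
    -- A copy blocked by the greedy family shares a centre with a member, which happens at most `N *
    -- A` times, or has a middle vertex off `S` in common with a member. The latter copies fall into
    -- at most `N * (r * r)` classes; within a class the middle vertex on one branch `i ∉ S` is
    -- constant, so a large class is handled by induction with `insert i S`.
    · have hcov : 𝒮 ⊆ (𝓕.biUnion fun T' => {T ∈ 𝒮 | T.1 = T'.1}) ∪
          𝓕.biUnion fun T' => (univ : Finset (Fin r × Fin r)).biUnion fun ij =>
            {T ∈ 𝒮 | ij.1 ∉ S ∧ (T.2 ij.1).1 = (T'.2 ij.2).1} := by
        intro T hT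
        obtain ⟨T', hT', h⟩ := hp T hT
        simp only [mem_union, mem_biUnion, mem_filter, mem_univ, true_and]
        by_cases hz : T.1 = T'.1
        · exact Or.inl ⟨T', hT', hT, hz⟩
        · rcases h with rfl | h
          · exact absurd rfl hz
          · right
            simp only [Separate, not_and, not_forall, not_not] at h
            obtain ⟨i, hi, j, hj, hij⟩ := h hz
            exact ⟨T', hT', (i, j), hT, hi, hij⟩
      by_contra hcon
      have hsmall : ∀ T' ∈ 𝓕, ∀ ij : Fin r × Fin r,
          #{T ∈ 𝒮 | ij.1 ∉ S ∧ (T.2 ij.1).1 = (T'.2 ij.2).1}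
            ≤ sunflowerBound (N * A) (N * (r * r)) k := by
        rintro T' hT' ⟨i, j⟩
        by_contra hbig
        rw [not_le] at hbig
        by_cases hi : i ∈ S
        · simp [hi] at hbig
        · obtain ⟨S', 𝓕', h𝓕', hrest⟩ := ih {T ∈ 𝒮 | i ∉ S ∧ (T.2 i).1 = (T'.2 j).1} (insert i S)
            (by
              rw [compl_insert, card_erase_of_mem (mem_compl.2 hi), hS]; rfl)
            (fun z => (card_le_card (filter_subset_filter _ (filter_subset _ _))).trans (hA z))
            (by
              intro T₁ h₁ T₂ h₂ i' hi'
              rw [mem_filter] at h₁ h₂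
              rcases mem_insert.1 hi' with rfl | hi'
              · rw [h₁.2.2, h₂.2.2]
              · exact hy _ h₁.1 _ h₂.1 _ hi')
            hbig
          exact hcon ⟨S', 𝓕', h𝓕'.trans (filter_subset _ _), hrest⟩
      have h1 := (card_le_card hcov).trans (card_union_le _ _)
      have h2 := card_biUnion_le (s := 𝓕) (t := fun T' => {T ∈ 𝒮 | T.1 = T'.1}) |>.trans
        (sum_le_sum fun T _ => hA T.1)
      have h3 := card_biUnion_le (s := 𝓕) (t := fun T' =>
        (univ : Finset (Fin r × Fin r)).biUnion fun ij =>
            {T ∈ 𝒮 | ij.1 ∉ S ∧ (T.2 ij.1).1 = (T'.2 ij.2).1}) |>.trans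
        (sum_le_sum fun T hT => card_biUnion_le.trans (sum_le_sum fun ij _ => hsmall T hT ij))
      simp only [sum_const, smul_eq_mul, card_univ, Fintype.card_prod, Fintype.card_fin] at h2 h3
      have h4 : #𝓕 * A ≤ N * A := Nat.mul_le_mul_right _ hc.le
      have h5 : #𝓕 * (r * r * sunflowerBound (N * A) (N * (r * r)) k)
          ≤ N * (r * r) * sunflowerBound (N * A) (N * (r * r)) k := by
        rw [mul_assoc N]; exact Nat.mul_le_mul_right _ hc.le
      simp only [sunflowerBound] at hlt
      omega

section

variable {α β : Type} [Fintype α] [Fintype β] {G : SimpleGraph (α ⊕ β)} {r t L : ℕ}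
  {T : TreeCopy α β r t}

theorem adj_centre_of_mem_goodCopies (hT : T ∈ goodCopies G r t L) (i : Fin r) :
    G.Adj (.inl T.1) (.inr (T.2 i).1) := by
  have := (mem_filter.1 ((mem_filter.1 hT).2.1 i)).1
  exact (mem_filter.1 this).2.1

theorem adj_leaf_of_mem_goodCopies (hT : T ∈ goodCopies G r t L) (i : Fin r) (j : Fin t) :
    G.Adj (.inl ((T.2 i).2 j)) (.inr (T.2 i).1) := by
  have := (mem_filter.1 ((mem_filter.1 hT).2.1 i)).1
  exact (mem_filter.1 this).2.2 j

theorem light_of_mem_goodCopies (hT : T ∈ goodCopies G r t L) (i : Fin r) :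
    Light G L T.1 (T.2 i).2 :=
  (mem_filter.1 ((mem_filter.1 hT).2.1 i)).2

theorem mem_branches_of_mem_goodCopies (hT : T ∈ goodCopies G r t L) (i : Fin r) :
    T.2 i ∈ branches G t T.1 :=
  (mem_filter.1 ((mem_filter.1 hT).2.1 i)).1

theorem not_clash_of_mem_goodCopies (hT : T ∈ goodCopies G r t L) {p q : Fin r ⊕ Fin r × Fin t}
    (hpq : branchOf p ≠ branchOf q) : ¬ Clash G (branchVertex T.2 p) (branchVertex T.2 q) :=
  (mem_filter.1 hT).2.2 p q hpq

theorem mem_commonNbrs_of_mem_goodCopies (hT : T ∈ goodCopies G r t L) (i : Fin r) :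
    (T.2 i).1 ∈ commonNbrs G T.1 (T.2 i).2 := by
  rw [commonNbrs, mem_filter]
  exact ⟨mem_univ _, adj_centre_of_mem_goodCopies hT i, adj_leaf_of_mem_goodCopies hT i⟩

/-- Good copies with the same leaves and the same centre are few. -/
theorem card_fibre_le {𝒮 : Finset (TreeCopy α β r t)} (h𝒮 : 𝒮 ⊆ goodCopies G r t L)
    (x : Fin r → Fin t → α) (hx : ∀ T ∈ 𝒮, ∀ i, (T.2 i).2 = x i) (z : α) :
    #{T ∈ 𝒮 | T.1 = z} ≤ L ^ r := by
  by_cases hne : ({T ∈ 𝒮 | T.1 = z} : Finset _).Nonempty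
  · obtain ⟨T₀, hT₀⟩ := hne
    rw [mem_filter] at hT₀
    have hL : ∀ i, #(commonNbrs G z (x i)) ≤ L := by
      intro i
      have := (light_of_mem_goodCopies (h𝒮 hT₀.1) i).1
      rw [hx _ hT₀.1, hT₀.2] at this
      exact this.le
    have h1 : #{T ∈ 𝒮 | T.1 = z} ≤ #(Fintype.piFinset fun i => commonNbrs G z (x i)) := by
      refine card_le_card_of_injOn (fun T i => (T.2 i).1) ?_ ?_
      · intro T hT
        rw [mem_coe, mem_filter] at hT
        rw [mem_coe, Fintype.mem_piFinset]
        intro i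
        have := mem_commonNbrs_of_mem_goodCopies (h𝒮 hT.1) i
        rwa [hx _ hT.1, hT.2] at this
      · intro T hT T' hT' h
        rw [mem_coe, mem_filter] at hT hT'
        refine Prod.ext (hT.2.trans hT'.2.symm) (funext fun i => Prod.ext (congrFun h i) ?_)
        rw [hx _ hT.1, hx _ hT'.1]
    refine h1.trans ?_
    rw [Fintype.card_piFinset]
    refine (prod_le_prod' fun i _ => hL i).trans ?_
    simp
  · rw [not_nonempty_iff_eq_empty.1 hne]
    simp

/-- All but few good copies belong to a sunflower. -/
theorem card_not_isKernel_le (N : ℕ) :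
    #{T ∈ goodCopies G r t L | ∀ S, ¬ IsKernel (goodCopies G r t L) S N T}
      ≤ sunflowerBound (N * L ^ r) (N * (r * r)) r * Fintype.card α ^ (r * t) := by
  refine (card_le_mul_card_image (f := fun T : TreeCopy α β r t => fun i => (T.2 i).2) _
    (sunflowerBound (N * L ^ r) (N * (r * r)) r) ?_).trans ?_
  · intro x _
    by_contra hlt
    rw [not_le] at hlt
    set 𝒮 := ({T ∈ ({T ∈ goodCopies G r t L | ∀ S, ¬ IsKernel (goodCopies G r t L) S N T} :
      Finset (TreeCopy α β r t)) | (fun i => (T.2 i).2) = x} : Finset (TreeCopy α β r t)) with h𝒮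
    have hsub : 𝒮 ⊆ goodCopies G r t L := (filter_subset _ _).trans (filter_subset _ _)
    have hx : ∀ T ∈ 𝒮, ∀ i, (T.2 i).2 = x i := fun T hT i => congrFun (mem_filter.1 hT).2 i
    obtain ⟨S, 𝓕, h𝓕, hc, hy, hp⟩ := exists_sunflower (L ^ r) N r 𝒮 ∅ (by simp)
      (card_fibre_le hsub x hx) (by simp) hlt
    have hker : ∀ T ∈ 𝓕, IsKernel (goodCopies G r t L) S N T := by
      intro T hT
      refine ⟨𝓕, h𝓕.trans hsub, hc.ge, fun T' hT' => ⟨fun i => ?_, hy T' hT' T hT⟩, hp⟩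
      rw [hx _ (h𝓕 hT), hx _ (h𝓕 hT')]
    -- An empty family means `N = 0`, when every copy is trivially a kernel.
    rcases 𝓕.eq_empty_or_nonempty with rfl | ⟨T, hT⟩
    · have hne : 𝒮.Nonempty := card_pos.1 (by omega)
      obtain ⟨T, hT⟩ := hne
      refine (mem_filter.1 (mem_filter.1 hT).1).2 ∅ ⟨∅, by simp, ?_, by simp, by simp⟩
      simpa using hc.ge
    · exact (mem_filter.1 (mem_filter.1 (h𝓕 hT)).1).2 S (hker T hT)
  · refine Nat.mul_le_mul_left _ ((card_le_univ _).trans ?_)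
    simp only [Fintype.card_fun, Fintype.card_fin]
    rw [← pow_mul, mul_comm]

end

/-! ### From an empty kernel to the power -/

/-- Many pairwise separate good copies with common leaves yield an induced `F^ℓ_{r,t}`. -/
theorem exists_hasPower_of_isKernel (s r t ℓ : ℕ) (hs : 1 ≤ s) :
    ∃ N : ℕ, ∀ (α β : Type) [Fintype α] [Fintype β] (G : SimpleGraph (α ⊕ β)) (L : ℕ)
      (T : TreeCopy α β r t), (completeBipartiteGraph (Fin s) (Fin s)).Free G →
      IsKernel (goodCopies G r t L) ∅ N T → HasPower G r t ℓ := by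
  -- Only centres (`none`) and middle vertices of different petals are left to chance; goodness of
  -- the petals, which share their leaves, settles all other pairs.
  set I := (Fin ℓ × Option (Fin r)) × (Fin ℓ × Option (Fin r))
  set η : ℝ := 1 / (Fintype.card I + 1) with hη
  obtain ⟨N, hN0, hN⟩ := exists_clash_bound s hs η (by positivity)
  refine ⟨N, ?_⟩
  rintro α β _ _ G L T hfree ⟨𝓕, h𝓕, hc, hagree, hsep⟩
  obtain ⟨Q, hQ, hQc⟩ := exists_subset_card_eq hc
  let e : Fin N → TreeCopy α β r t := fun k => ((Q.equivFinOfCardEq hQc).symm k).1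
  have he : ∀ k, e k ∈ 𝓕 := fun k => hQ ((Q.equivFinOfCardEq hQc).symm k).2
  have heinj : Injective e := fun k k' hk => (Q.equivFinOfCardEq hQc).symm.injective (Subtype.ext hk)
  have : Nonempty (Fin N) := ⟨⟨0, hN0⟩⟩
  let vert : TreeCopy α β r t → Option (Fin r) → α ⊕ β := fun T o =>
    o.elim (.inl T.1) fun i => .inr (T.2 i).1
  have hvinj : ∀ o, Injective fun k => vert (e k) o := by
    intro o k k' hk
    by_contra hne
    have hs := hsep (he k) (he k') fun h => hne (heinj h)
    rcases o with _ | i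
    · exact hs.1 (Sum.inl_injective hk)
    · exact hs.2 i (by simp) i (by simp) (Sum.inr_injective hk)
  obtain ⟨ω, hω⟩ := exists_avoiding (Ω := Fin ℓ → Fin N) (I := I)
    (fun i ω => i.1.1 ≠ i.2.1 ∧ Clash G (vert (e (ω i.1.1)) i.1.2) (vert (e (ω i.2.1)) i.2.2)) η (by
      rintro ⟨⟨a, o⟩, ⟨b, o'⟩⟩
      by_cases hab : a ≠ b
      · refine le_trans ?_ (clash_fraction_le (Ω := fun _ : Fin ℓ => Fin N) (hN _ G hfree)
          (fun ω => vert (e (ω a)) o) (fun ω => vert (e (ω b)) o') a b hab ?_ ?_ ?_ ?_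
          (Fintype.card_fin N).ge (Fintype.card_fin N).ge)
        · gcongr
          exact fun h => h.2
        · intro ω; simpa using hvinj o
        · intro ω; simpa using hvinj o'
        · intro ω k; simp only [update_of_ne hab]
        · intro ω k; simp only [update_of_ne hab.symm]
      · have : ∀ ω : Fin ℓ → Fin N,
            ¬ (a ≠ b ∧ Clash G (vert (e (ω a)) o) (vert (e (ω b)) o')) := by tauto
        simp only [this]
        simp
        positivity) (by
      rw [hη, mul_one_div, div_lt_one (by positivity)]
      linarith)
  have hgood : ∀ a, e (ω a) ∈ goodCopies G r t L := fun a => h𝓕 (he _)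
  have hleaf : ∀ a i, ((e (ω a)).2 i).2 = (T.2 i).2 := fun a i => (hagree _ (he _)).1 i
  -- `T` itself need not be good and `ℓ` may be zero, so a fixed petal certifies that the leaves do
  -- not clash.
  have hT₀ : e ⟨0, hN0⟩ ∈ goodCopies G r t L := h𝓕 (he _)
  have hleaf₀ : ∀ i, ((e ⟨0, hN0⟩).2 i).2 = (T.2 i).2 := fun i => (hagree _ (he _)).1 i
  have hcross : ∀ a b o o', a ≠ b → ¬ Clash G (vert (e (ω a)) o) (vert (e (ω b)) o') :=
    fun a b o o' hab h => hω ((a, o), (b, o')) ⟨hab, h⟩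
  let x : Fin r × Fin t → α := fun p => (T.2 p.1).2 p.2
  let z : Fin ℓ → α := fun a => (e (ω a)).1
  let y : Fin ℓ × Fin r → β := fun p => ((e (ω p.1)).2 p.2).1
  have hzy : ∀ a i, G.Adj (.inl (z a)) (.inr (y (a, i))) := fun a i =>
    adj_centre_of_mem_goodCopies (hgood a) i
  have hxy : ∀ a i j, G.Adj (.inl (x (i, j))) (.inr (y (a, i))) := fun a i j => by
    have := adj_leaf_of_mem_goodCopies (hgood a) i j
    rwa [hleaf] at this
  have hxy' : ∀ a i k j, k ≠ i → ¬ Clash G (.inl (x (k, j))) (.inr (y (a, i))) := by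
    intro a i k j hki
    have := not_clash_of_mem_goodCopies (hgood a) (p := .inr (k, j)) (q := .inl i) hki
    simpa only [branchVertex, Sum.elim_inl, Sum.elim_inr, hleaf] using this
  have hxz : ∀ p a, ¬ Clash G (.inl (x p)) (.inl (z a)) := by
    intro p a h
    have := (light_of_mem_goodCopies (hgood a) p.1).2.1 p.2
    rw [hleaf] at this
    exact this h.symm
  have hxx : ∀ p q, p ≠ q → ¬ Clash G (.inl (x p)) (.inl (x q)) := by
    rintro ⟨i, j⟩ ⟨k, j'⟩ hpq
    by_cases hik : i = k
    · subst hik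
      have := (light_of_mem_goodCopies hT₀ i).2.2 j j' (fun h => hpq (by rw [h]))
      rwa [hleaf₀] at this
    · have := not_clash_of_mem_goodCopies hT₀ (p := .inr (i, j)) (q := .inr (k, j')) hik
      simpa only [branchVertex, Sum.elim_inl, Sum.elim_inr, hleaf₀] using this
  have hyy : ∀ p q, p ≠ q → ¬ Clash G (.inr (y p)) (.inr (y q)) := by
    rintro ⟨a, i⟩ ⟨b, k⟩ hpq
    by_cases hab : a = b
    · subst hab
      exact not_clash_of_mem_goodCopies (hgood a) (p := .inl i) (q := .inl k)
        fun h => hpq (by rw [show i = k from h])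
    · exact hcross a b (some i) (some k) hab
  refine ⟨x, z, y, ?_⟩
  rintro (p | a | p) (q | b | q) hpq
  · exact ⟨False.elim, fun _ => hxx p q fun h => hpq (by rw [h])⟩
  · exact ⟨False.elim, fun _ => hxz p b⟩
  · obtain ⟨i, j⟩ := p
    obtain ⟨b, k⟩ := q
    refine ⟨fun h => ?_, fun h => hxy' b k i j h⟩
    obtain rfl : i = k := h
    exact hxy b i j
  · exact ⟨False.elim, fun _ h => hxz q a h.symm⟩
  · exact ⟨False.elim, fun _ => hcross a b none none fun h => hpq (by rw [h])⟩
  · obtain ⟨b, k⟩ := q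
    refine ⟨fun h => ?_, fun h => hcross a b none (some k) h⟩
    obtain rfl : a = b := h
    exact hzy a k
  · obtain ⟨i, j⟩ := q
    obtain ⟨b, k⟩ := p
    refine ⟨fun h => ?_, fun h h' => hxy' b k i j h h'.symm⟩
    obtain rfl : i = k := h
    exact (hxy b i j).symm
  · obtain ⟨a, k⟩ := p
    refine ⟨fun h => ?_, fun h h' => hcross b a none (some k) h h'.symm⟩
    obtain rfl : b = a := h
    exact (hzy b k).symm
  · exact ⟨False.elim, fun _ => hyy p q fun h => hpq (by rw [h])⟩

/-! ### Erasing a branch from the kernel -/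

/-- Applied to the petals of a sunflower, which are therefore kernels themselves. -/
theorem IsKernel.congr {α β : Type} {r t : ℕ} {𝒯 : Finset (TreeCopy α β r t)} {S : Finset (Fin r)}
    {N : ℕ} {T T' : TreeCopy α β r t} (h : IsKernel 𝒯 S N T) (hx : ∀ i, (T'.2 i).2 = (T.2 i).2)
    (hy : ∀ i ∈ S, (T'.2 i).1 = (T.2 i).1) : IsKernel 𝒯 S N T' := by
  obtain ⟨𝓕, h𝓕, hc, ha, hp⟩ := h
  refine ⟨𝓕, h𝓕, hc, fun T'' hT'' => ⟨fun i => ?_, fun i hi => ?_⟩, hp⟩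
  · rw [hx, (ha _ hT'').1]
  · rw [hy i hi, (ha _ hT'').2 i hi]

theorem IsKernel.mono {α β : Type} {r t : ℕ} {𝒯 : Finset (TreeCopy α β r t)} {S : Finset (Fin r)}
    {N N' : ℕ} {T : TreeCopy α β r t} (h : IsKernel 𝒯 S N T) (hN : N' ≤ N) : IsKernel 𝒯 S N' T := by
  obtain ⟨𝓕, h𝓕, hc, ha, hp⟩ := h
  exact ⟨𝓕, h𝓕, hN.trans hc, ha, hp⟩

/-- A large family of separate copies has a member that avoids a given small set. -/
theorem exists_copy_avoiding {α β : Type} {r t : ℕ} {S : Finset (Fin r)}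
    {𝓕 : Finset (TreeCopy α β r t)} (hp : (𝓕 : Set (TreeCopy α β r t)).Pairwise (Separate S))
    (A : Finset α) (B : Finset β) (h : #A + #B < #𝓕) :
    ∃ T ∈ 𝓕, T.1 ∉ A ∧ ∀ j ∉ S, (T.2 j).1 ∉ B := by
  by_contra hcon
  push Not at hcon
  -- Each copy meeting `A` or `B` is charged to one element that it uses; separateness makes the
  -- charge injective.
  have hw : ∀ T, ∃ q : α ⊕ β, T ∈ 𝓕 → q ∈ A.disjSum B ∧
      (q = .inl T.1 ∨ ∃ j ∉ S, q = .inr (T.2 j).1) := by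
    intro T
    by_cases hT : T ∈ 𝓕
    · by_cases hA : T.1 ∈ A
      · exact ⟨.inl T.1, fun _ => ⟨by simpa using hA, Or.inl rfl⟩⟩
      · obtain ⟨j, hj, hB⟩ := hcon T hT hA
        exact ⟨.inr (T.2 j).1, fun _ => ⟨by simpa using hB, Or.inr ⟨j, hj, rfl⟩⟩⟩
    · exact ⟨.inl T.1, fun h => absurd h hT⟩
  choose w hw using hw
  have : #𝓕 ≤ #(A.disjSum B) := by
    refine card_le_card_of_injOn w (fun T hT => (hw T hT).1) ?_
    intro T hT T' hT' heq
    by_contra hne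
    have hs := hp hT hT' hne
    rcases (hw T hT).2 with h1 | ⟨j, hj, h1⟩ <;> rcases (hw T' hT').2 with h2 | ⟨j', hj', h2⟩ <;>
      rw [h1, h2] at heq
    · exact hs.1 (Sum.inl_injective heq)
    · cases heq
    · cases heq
    · exact hs.2 j hj j' hj' (Sum.inr_injective heq)
  rw [card_disjSum] at this
  omega

/-- If, for `N` choices of the middle vertex on branch `i`, the copy becomes a large kernel for `S`,
then it is a kernel for `S.erase i`. -/
theorem isKernel_erase {α β : Type} {r t : ℕ} {𝒯 : Finset (TreeCopy α β r t)} {S : Finset (Fin r)}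
    {i : Fin r} (hi : i ∈ S) {N N' : ℕ} (hN : (r + 2) * N < N') (T₀ : TreeCopy α β r t)
    (Y : Finset β) (hY : N ≤ #Y)
    (h : ∀ y ∈ Y, ∃ T, (∀ j, (T.2 j).2 = (T₀.2 j).2) ∧
      (∀ j ∈ S.erase i, (T.2 j).1 = (T₀.2 j).1) ∧ (T.2 i).1 = y ∧ IsKernel 𝒯 S N' T) :
    IsKernel 𝒯 (S.erase i) N T₀ := by
  obtain ⟨Y₀, hY₀, hcard⟩ := exists_subset_card_eq hY
  -- One petal is taken from the sunflower of each `y` in turn. Off `S` it avoids all of `Y₀`,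
  -- including the values still to come on branch `i`. At most `N` centres, `N` elements of `Y₀` and
  -- `N * r` middle vertices must be avoided, whence `(r + 2) * N`.
  have key : ∀ Y' ⊆ Y₀, ∃ 𝓖 ⊆ 𝒯, #𝓖 = #Y' ∧
      (∀ T ∈ 𝓖, ((∀ j, (T.2 j).2 = (T₀.2 j).2) ∧ ∀ j ∈ S.erase i, (T.2 j).1 = (T₀.2 j).1) ∧
        (T.2 i).1 ∈ Y' ∧ ∀ j ∉ S, (T.2 j).1 ∉ Y₀) ∧
      (𝓖 : Set (TreeCopy α β r t)).Pairwise (Separate (S.erase i)) := by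
    intro Y'
    induction Y' using Finset.induction_on with
    | empty => exact fun _ => ⟨∅, by simp⟩
    | insert y Y' hy ih =>
      intro hsub
      rw [insert_subset_iff] at hsub
      obtain ⟨𝓖, h𝓖, hc, hG, hp⟩ := ih hsub.2
      obtain ⟨T₁, hx₁, hy₁, hyi, 𝓕, h𝓕, hc𝓕, ha, hp𝓕⟩ := h y (hY₀ hsub.1)
      have hYN : #Y' ≤ N := by rw [← hcard]; exact card_le_card hsub.2
      obtain ⟨T, hT, hTA, hTB⟩ := exists_copy_avoiding hp𝓕 (𝓖.image Prod.fst)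
        (Y₀ ∪ 𝓖.biUnion fun T => univ.image fun j => (T.2 j).1) (by
          have h1 : #(𝓖.image Prod.fst) ≤ N := card_image_le.trans (hc.trans_le hYN)
          have h2 : #(𝓖.biUnion fun T => univ.image fun j => (T.2 j).1) ≤ N * r := by
            refine card_biUnion_le.trans ((sum_le_card_nsmul _ _ r fun T _ => ?_).trans ?_)
            · exact card_image_le.trans (by simp)
            · rw [smul_eq_mul, hc]; exact Nat.mul_le_mul_right _ hYN
          have h3 := card_union_le Y₀ (𝓖.biUnion fun T => univ.image fun j => (T.2 j).1)
          have h4 : (r + 2) * N = N + (N + N * r) := by ring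
          omega)
      have hTi : (T.2 i).1 = y := by rw [(ha T hT).2 i hi, hyi]
      have hsep : ∀ T' ∈ 𝓖, Separate (S.erase i) T T' := by
        intro T' hT'
        refine ⟨fun heq => hTA (mem_image.2 ⟨T', hT', heq.symm⟩), ?_⟩
        intro j hj k hk heq
        by_cases hji : j = i
        · subst hji
          rw [hTi] at heq
          by_cases hkj : k = j
          · subst hkj
            exact hy (heq ▸ (hG T' hT').2.1)
          · exact (hG T' hT').2.2 k (fun hkS => hk (mem_erase.2 ⟨hkj, hkS⟩)) (heq ▸ hsub.1)
        · refine hTB j (fun hjS => hj (mem_erase.2 ⟨hji, hjS⟩)) (mem_union_right _ ?_)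
          rw [mem_biUnion]
          exact ⟨T', hT', mem_image.2 ⟨k, mem_univ _, heq.symm⟩⟩
      have hTG : T ∉ 𝓖 := fun hmem => (hsep T hmem).1 rfl
      refine ⟨insert T 𝓖, insert_subset (h𝓕 hT) h𝓖, ?_, ?_, ?_⟩
      · rw [card_insert_of_notMem hTG, card_insert_of_notMem hy, hc]
      · intro T' hT'
        rcases mem_insert.1 hT' with rfl | hT'
        · refine ⟨⟨fun j => ?_, fun j hj => ?_⟩, ?_, fun j hj hm => ?_⟩
          · rw [(ha _ hT).1, hx₁]
          · rw [(ha _ hT).2 j (mem_of_mem_erase hj), hy₁ j hj]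
          · rw [hTi]; exact mem_insert_self _ _
          · exact hTB j hj (mem_union_left _ hm)
        · exact ⟨(hG T' hT').1, mem_insert_of_mem (hG T' hT').2.1, (hG T' hT').2.2⟩
      · rw [coe_insert]
        exact hp.insert fun b hb _ => ⟨hsep b hb, (hsep b hb).symm⟩
  obtain ⟨𝓖, h𝓖, hc, hG, hp⟩ := key Y₀ subset_rfl
  exact ⟨𝓖, h𝓖, (hc.trans hcard).ge, fun T hT => (hG T hT).1, hp⟩

/-- The number of pairs of a vertex `y` and a light tuple in a set `Z y` of neighbours of `y`. -/
theorem sum_card_lightTuples_le {α β : Type} [Fintype α] [Fintype β] (G : SimpleGraph (α ⊕ β))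
    (t L : ℕ) (W : Finset β) (Z : Finset α) (Zy : β → Finset α) (hZ : ∀ y, Zy y ⊆ Z)
    (hadj : ∀ y, ∀ z ∈ Zy y, G.Adj (.inl z) (.inr y)) :
    ∑ y ∈ W, #(lightTuples G t L (Zy y)) ≤ L * #Z ^ (t + 1) := by
  have h1 : ∀ y, lightTuples G t L (Zy y)
      = {g ∈ lightTuples G t L Z | g ∈ lightTuples G t L (Zy y)} := by
    intro y
    ext g
    simp only [lightTuples, mem_filter, mem_univ, true_and]
    exact ⟨fun h => ⟨⟨hZ y h.1, fun j => hZ y (h.2.1 j), h.2.2⟩, h⟩, fun h => h.2⟩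
  calc ∑ y ∈ W, #(lightTuples G t L (Zy y))
      = ∑ y ∈ W, ∑ g ∈ lightTuples G t L Z, if g ∈ lightTuples G t L (Zy y) then 1 else 0 := by
        refine sum_congr rfl fun y _ => ?_
        conv_lhs => rw [h1 y, card_filter]
    _ = ∑ g ∈ lightTuples G t L Z, #{y ∈ W | g ∈ lightTuples G t L (Zy y)} := by
        rw [sum_comm]
        refine sum_congr rfl fun g _ => ?_
        rw [card_filter]
    -- Every `y` counted for `g` is a common neighbour of `g`, and lightness leaves fewer than `L`
    -- of these.
    _ ≤ ∑ _g ∈ lightTuples G t L Z, L := by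
        refine sum_le_sum fun g hg => ?_
        refine le_trans (card_le_card ?_) (mem_filter.1 hg).2.2.2.1.le
        intro y hy
        have h2 := (mem_filter.1 (mem_filter.1 hy).2).2
        rw [commonNbrs, mem_filter]
        exact ⟨mem_univ _, hadj y _ h2.1, fun j => hadj y _ (h2.2.1 j)⟩
    _ = L * #(lightTuples G t L Z) := by rw [sum_const, smul_eq_mul, mul_comm]
    _ ≤ L * #(Z ×ˢ Fintype.piFinset fun _ : Fin t => Z) := by
        refine Nat.mul_le_mul_left _ (card_le_card ?_)
        intro g hg
        have h2 := (mem_filter.1 hg).2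
        rw [mem_product, Fintype.mem_piFinset]
        exact ⟨h2.1, h2.2.1⟩
    _ = L * #Z ^ (t + 1) := by
        simp only [card_product, Fintype.card_piFinset, prod_const, card_univ, Fintype.card_fin]
        ring

/-- A family of good copies that agree in the leaves off branch `i`, that has few pairs of a middle
vertex and a tuple of leaves on branch `i`, and in which every middle vertex on branch `i` is joined
to many centres, is small relative to its number of centres unless `Δ` is small. -/
theorem pow_degree_le_of_family (r t m L N : ℕ) (c ε : ℝ) (hc : 0 < c) (hε : 0 < ε) :
    ∃ C : ℝ, ∀ (α β : Type) [Fintype α] [Fintype β] (G : SimpleGraph (α ⊕ β)) (n Δ K : ℕ),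
      AlmostRegular G n Δ K →
      (∀ P : Finset α, m ≤ #P → c * (#P : ℝ) ^ (t + 1) ≤ #(lightTuples G t L P)) → 0 < Δ →
      ∀ (i : Fin r) (U : Finset (TreeCopy α β r t)), U ⊆ goodCopies G r t L → U.Nonempty →
      (∀ T ∈ U, ∀ T' ∈ U, ∀ j ≠ i, (T.2 j).2 = (T'.2 j).2) →
      (∀ x, #{p ∈ U.image fun T => T.2 i | p.2 = x} ≤ N) →
      (∀ T ∈ U, m ≤ #(({T' ∈ U | (T'.2 i).1 = (T.2 i).1} : Finset _).image Prod.fst)) →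
      ε * Δ ^ (t + 1) * #(U.image Prod.fst) ≤ #U →
      (Δ : ℝ) ^ (t ^ 2 + t + 1) ≤ C * n ^ (t ^ 2) := by
  -- The loss in passing from copies to pairs of a centre and a branch `i`: the other leaves are
  -- fixed in `U`, so lightness leaves at most `L^r` copies per pair.
  set ε₂ : ℝ := ε / (L ^ r + 1) with hε₂
  have hε₂0 : 0 < ε₂ := by positivity
  refine ⟨L * (2 * N / ε₂) ^ t / (c * (ε₂ / 2) ^ (t + 1)), ?_⟩
  intro α β _ _ G n Δ K hG hlight hΔ i U hU hne hleaf hN hm hbig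
  have hΔr : (0 : ℝ) < Δ := by exact_mod_cast hΔ
  set Z := U.image Prod.fst with hZdef
  have hZpos : (0 : ℝ) < #Z := by exact_mod_cast card_pos.2 (hne.image _)
  set R := U.image fun T => (T.1, T.2 i) with hR
  set P := U.image fun T => T.2 i with hP
  set Zy : β → Finset α := fun y => ({T ∈ U | (T.2 i).1 = y} : Finset _).image Prod.fst with hZy
  set Xy : β → Finset (β × (Fin t → α)) := fun y => {p ∈ P | p.1 = y} with hXy
  have hZyZ : ∀ y, Zy y ⊆ Z := fun y => image_subset_image (filter_subset _ _)
  have hZyadj : ∀ y, ∀ z ∈ Zy y, G.Adj (.inl z) (.inr y) := by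
    intro y z hz
    obtain ⟨T, hT, rfl⟩ := mem_image.1 hz
    obtain ⟨hTU, rfl⟩ := mem_filter.1 hT
    exact adj_centre_of_mem_goodCopies (hU hTU) i
  have hUR : #U ≤ L ^ r * #R := by
    refine card_le_mul_card_image U _ fun ρ _ => ?_
    by_cases hne' : ({T ∈ U | (T.1, T.2 i) = ρ} : Finset _).Nonempty
    · obtain ⟨T₀, hT₀⟩ := hne'
      obtain ⟨hT₀, hρ₀⟩ := mem_filter.1 hT₀
      refine le_trans (card_le_card ?_) (card_fibre_le (𝒮 := {T ∈ U | (T.1, T.2 i) = ρ})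
        ((filter_subset _ _).trans hU) (fun j => (T₀.2 j).2) ?_ ρ.1)
      · intro T hT
        rw [mem_filter]
        exact ⟨hT, by rw [← (mem_filter.1 hT).2]⟩
      · intro T hT j
        obtain ⟨hT, hρ⟩ := mem_filter.1 hT
        by_cases hj : j = i
        · subst hj
          have : (T.2 j) = T₀.2 j := congrArg Prod.snd (hρ.trans hρ₀.symm)
          rw [this]
        · exact hleaf T hT T₀ hT₀ j hj
    · rw [not_nonempty_iff_eq_empty.1 hne']
      simp
  have hPcard : #P ≤ N * n ^ t := by
    refine (card_le_mul_card_image (f := Prod.snd) P N fun x _ => hN x).trans ?_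
    refine Nat.mul_le_mul_left _ ((card_le_univ _).trans ?_)
    rw [Fintype.card_fun, Fintype.card_fin]
    exact Nat.pow_le_pow_left hG.card_left t
  have hXcard : ∀ y, #(Xy y) ≤ Δ ^ t := by
    intro y
    refine le_trans (card_le_card_of_injOn (t := Fintype.piFinset fun _ : Fin t => nbrsL G y)
      Prod.snd ?_ ?_) ?_
    · intro p hp
      obtain ⟨hpP, rfl⟩ := mem_filter.1 hp
      obtain ⟨T, hT, rfl⟩ := mem_image.1 hpP
      rw [mem_coe, Fintype.mem_piFinset]
      intro j
      rw [nbrsL, mem_filter]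
      exact ⟨mem_univ _, adj_leaf_of_mem_goodCopies (hU hT) i j⟩
    · intro p hp q hq h
      exact Prod.ext ((mem_filter.1 hp).2.trans (mem_filter.1 hq).2.symm) h
    · simp only [Fintype.card_piFinset, prod_const, card_univ, Fintype.card_fin]
      exact Nat.pow_le_pow_left (hG.nbrsL_le y) t
  have hRle : #R ≤ ∑ y, #(Zy y) * #(Xy y) := by
    have hsub : R ⊆ univ.biUnion fun y => Zy y ×ˢ Xy y := by
      intro ρ hρ
      obtain ⟨T, hT, rfl⟩ := mem_image.1 hρ
      simp only [mem_biUnion, mem_univ, true_and, mem_product]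
      exact ⟨(T.2 i).1, mem_image.2 ⟨T, mem_filter.2 ⟨hT, rfl⟩, rfl⟩,
        mem_filter.2 ⟨mem_image_of_mem _ hT, rfl⟩⟩
    refine (card_le_card hsub).trans (card_biUnion_le.trans (le_of_eq ?_))
    simp only [card_product]
  have hZsum : ∑ y, #(Zy y) ≤ #Z * Δ := by
    have h1 : ∀ y, #(Zy y) ≤ ∑ z ∈ Z, if G.Adj (.inl z) (.inr y) then 1 else 0 := by
      intro y
      rw [← card_filter]
      exact card_le_card fun z hz => mem_filter.2 ⟨hZyZ y hz, hZyadj y z hz⟩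
    refine (sum_le_sum fun y _ => h1 y).trans ?_
    rw [sum_comm]
    refine (sum_le_card_nsmul _ _ Δ fun z _ => ?_).trans (by rw [smul_eq_mul])
    rw [← card_filter]
    exact hG.nbrsR_le z
  have hPsum : ∑ y, #(Xy y) = #P :=
    (card_eq_sum_card_fiberwise (f := Prod.fst) (t := univ) (fun _ _ => mem_coe.2 (mem_univ _))).symm
  have hRlow : ε₂ * Δ ^ (t + 1) * #Z ≤ #R := by
    have h1 : (#U : ℝ) ≤ (L ^ r + 1) * #R := by
      have : (#U : ℝ) ≤ L ^ r * #R := by exact_mod_cast hUR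
      have h2 : (0 : ℝ) ≤ #R := by positivity
      linarith
    have h3 := hbig.trans h1
    rw [hε₂, div_mul_eq_mul_div, div_mul_eq_mul_div, div_le_iff₀ (by positivity)]
    linarith
  -- Middle vertices with a positive proportion of the `Δ^t` possible leaf tuples. They are few
  -- because `P` is small, yet the others account for at most half of the lower bound for `#R`, so
  -- `W` still receives of order `Δ * #Z` edges from the centres.
  set W : Finset β := {y | ε₂ / 2 * Δ ^ t ≤ #(Xy y)} with hW
  have hWcard : ε₂ / 2 * Δ ^ t * #W ≤ N * n ^ t := by
    have h1 : ∑ _y ∈ W, ε₂ / 2 * (Δ : ℝ) ^ t ≤ ∑ y ∈ W, (#(Xy y) : ℝ) :=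
      sum_le_sum fun y hy => (mem_filter.1 hy).2
    have h2 : ∑ y ∈ W, (#(Xy y) : ℝ) ≤ ∑ y, (#(Xy y) : ℝ) :=
      sum_le_sum_of_subset_of_nonneg (subset_univ _) fun _ _ _ => by positivity
    have h3 : ∑ y, (#(Xy y) : ℝ) ≤ N * n ^ t := by
      have : ∑ y, #(Xy y) ≤ N * n ^ t := hPsum.trans_le hPcard
      exact_mod_cast this
    rw [sum_const, nsmul_eq_mul] at h1
    linarith
  have hWZ : ε₂ / 2 * Δ * #Z ≤ ∑ y ∈ W, (#(Zy y) : ℝ) := by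
    have h1 : (#R : ℝ) ≤ ∑ y, (#(Zy y) * #(Xy y) : ℝ) := by exact_mod_cast hRle
    rw [← sum_filter_add_sum_filter_not univ (fun y => ε₂ / 2 * (Δ : ℝ) ^ t ≤ #(Xy y))] at h1
    have h2 : ∑ y ∈ W, (#(Zy y) * #(Xy y) : ℝ) ≤ ∑ y ∈ W, (#(Zy y) : ℝ) * Δ ^ t := by
      refine sum_le_sum fun y _ => ?_
      gcongr
      exact_mod_cast hXcard y
    have h3 : ∑ y with ¬ ε₂ / 2 * (Δ : ℝ) ^ t ≤ #(Xy y), (#(Zy y) * #(Xy y) : ℝ)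
        ≤ ∑ y, (#(Zy y) : ℝ) * (ε₂ / 2 * Δ ^ t) := by
      refine (sum_le_sum fun y hy => ?_).trans
        (sum_le_sum_of_subset_of_nonneg (filter_subset _ _) fun _ _ _ => by positivity)
      have := (mem_filter.1 hy).2
      rw [not_le] at this
      gcongr
    have h4 : ∑ y, (#(Zy y) : ℝ) * (ε₂ / 2 * Δ ^ t) ≤ #Z * Δ * (ε₂ / 2 * Δ ^ t) := by
      rw [← sum_mul]
      gcongr
      exact_mod_cast hZsum
    rw [← sum_mul] at h2
    have h5 : ε₂ * Δ ^ (t + 1) * #Z ≤ (∑ y ∈ W, (#(Zy y) : ℝ)) * Δ ^ t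
        + #Z * Δ * (ε₂ / 2 * Δ ^ t) := by linarith
    have h6 : Δ ^ t * (ε₂ / 2 * Δ * #Z) ≤ Δ ^ t * ∑ y ∈ W, (#(Zy y) : ℝ) := by
      rw [pow_succ] at h5
      linarith
    exact le_of_mul_le_mul_left h6 (by positivity)
  have hWlarge : ∀ y ∈ W, m ≤ #(Zy y) := by
    intro y hy
    have h1 := (mem_filter.1 hy).2
    have h2 : (0 : ℝ) < #(Xy y) := lt_of_lt_of_le (by positivity) h1
    obtain ⟨p, hp⟩ := card_pos.1 (Nat.cast_pos.1 h2)
    obtain ⟨hpP, rfl⟩ := mem_filter.1 hp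
    obtain ⟨T, hT, rfl⟩ := mem_image.1 hpP
    exact hm T hT
  have hlightsum : c * ∑ y ∈ W, (#(Zy y) : ℝ) ^ (t + 1) ≤ L * #Z ^ (t + 1) := by
    rw [mul_sum]
    refine (sum_le_sum fun y hy => hlight _ (hWlarge y hy)).trans ?_
    exact_mod_cast sum_card_lightTuples_le G t L W Z Zy hZyZ hZyadj
  have hpow := pow_sum_le_mul_sum_pow W (fun y => (#(Zy y) : ℝ)) (fun _ _ => by positivity) t
    (#W) le_rfl
  -- Convexity against `hlightsum` forces `#W ^ t` to be at least of order `Δ^(t+1)`, whereas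
  -- `hWcard` keeps `Δ^t * #W` within order `n^t`.
  have h1 : (ε₂ / 2 * Δ * #Z) ^ (t + 1) ≤ #W ^ t * ∑ y ∈ W, (#(Zy y) : ℝ) ^ (t + 1) :=
    (pow_le_pow_left₀ (by positivity) hWZ _).trans hpow
  have h2 : #Z ^ (t + 1) * (c * (ε₂ / 2) ^ (t + 1) * Δ ^ (t + 1))
      ≤ #Z ^ (t + 1) * (L * (#W : ℝ) ^ t) := by
    calc #Z ^ (t + 1) * (c * (ε₂ / 2) ^ (t + 1) * Δ ^ (t + 1))
        = c * (ε₂ / 2 * Δ * #Z) ^ (t + 1) := by rw [mul_pow, mul_pow]; ring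
      _ ≤ c * (#W ^ t * ∑ y ∈ W, (#(Zy y) : ℝ) ^ (t + 1)) := by gcongr
      _ = #W ^ t * (c * ∑ y ∈ W, (#(Zy y) : ℝ) ^ (t + 1)) := by ring
      _ ≤ #W ^ t * (L * #Z ^ (t + 1)) := by gcongr
      _ = _ := by ring
  have h3 := le_of_mul_le_mul_left h2 (by positivity)
  have h4 : (Δ : ℝ) ^ t * #W ≤ 2 * N / ε₂ * n ^ t := by
    rw [div_mul_eq_mul_div, le_div_iff₀ hε₂0]
    nlinarith
  have h5 : ((Δ : ℝ) ^ t * #W) ^ t ≤ (2 * N / ε₂ * n ^ t) ^ t :=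
    pow_le_pow_left₀ (by positivity) h4 t
  rw [div_mul_eq_mul_div, le_div_iff₀ (by positivity)]
  calc (Δ : ℝ) ^ (t ^ 2 + t + 1) * (c * (ε₂ / 2) ^ (t + 1))
      = Δ ^ (t ^ 2) * (c * (ε₂ / 2) ^ (t + 1) * Δ ^ (t + 1)) := by ring
    _ ≤ Δ ^ (t ^ 2) * (L * (#W : ℝ) ^ t) := by gcongr
    _ = L * ((Δ : ℝ) ^ t * #W) ^ t := by rw [mul_pow, ← pow_mul, ← sq]; ring
    _ ≤ L * (2 * N / ε₂ * n ^ t) ^ t := by gcongr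
    _ = L * (2 * N / ε₂) ^ t * n ^ (t ^ 2) := by rw [mul_pow, ← pow_mul, ← sq]; ring

/-- What the branches other than `i` prescribe: their leaves, and their middle vertices if they
belong to `S`. -/
noncomputable def context {α β : Type} {r t : ℕ} (S : Finset (Fin r)) (i : Fin r)
    (w : {j : Fin r // j ≠ i} → β × (Fin t → α)) (j : Fin r) :
    Option ((Fin t → α) × Option β) :=
  if h : j = i then none else some ((w ⟨j, h⟩).2, if j ∈ S then some (w ⟨j, h⟩).1 else none)

theorem context_eq_iff {α β : Type} {r t : ℕ} {S : Finset (Fin r)} {i : Fin r}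
    {w w' : {j : Fin r // j ≠ i} → β × (Fin t → α)} :
    context S i w = context S i w' ↔
      ∀ j, (w j).2 = (w' j).2 ∧ (j.1 ∈ S → (w j).1 = (w' j).1) := by
  constructor
  · rintro h ⟨j, hj⟩
    have := congrFun h j
    simp only [context, dif_neg hj, Option.some.injEq, Prod.mk.injEq] at this
    refine ⟨this.1, fun hS => ?_⟩
    simpa [hS] using this.2
  · intro h
    funext j
    by_cases hj : j = i
    · simp [context, hj]
    · simp only [context, dif_neg hj, Option.some.injEq, Prod.mk.injEq]
      refine ⟨(h ⟨j, hj⟩).1, ?_⟩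
      by_cases hS : j ∈ S
      · simp [hS, (h ⟨j, hj⟩).2 hS]
      · simp [hS]

/-- The context of a copy. -/
noncomputable def ctx {α β : Type} {r t : ℕ} (S : Finset (Fin r)) (i : Fin r)
    (T : TreeCopy α β r t) : Fin r → Option ((Fin t → α) × Option β) :=
  context S i fun j => T.2 j.1

/-- There are few pairs of a centre and a context. -/
theorem card_centre_ctx_le {α β : Type} [Fintype α] [Fintype β] {G : SimpleGraph (α ⊕ β)}
    {n Δ K r t L : ℕ} (hG : AlmostRegular G n Δ K) (S : Finset (Fin r)) (i : Fin r)
    (U : Finset (TreeCopy α β r t)) (hU : U ⊆ goodCopies G r t L) :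
    #(U.image fun T => (T.1, ctx S i T)) ≤ n * (Δ ^ (t + 1)) ^ (r - 1) := by
  have hsub : (U.image fun T => (T.1, ctx S i T)) ⊆
      ((univ : Finset α).biUnion fun z => ({z} : Finset α) ×ˢ
        Fintype.piFinset fun _ : {j : Fin r // j ≠ i} => branches G t z).image
          fun p => (p.1, context S i p.2) := by
    intro ρ hρ
    obtain ⟨T, hT, rfl⟩ := mem_image.1 hρ
    refine mem_image.2 ⟨(T.1, fun j => T.2 j.1), ?_, rfl⟩
    simp only [mem_biUnion, mem_univ, true_and, mem_product, mem_singleton, Fintype.mem_piFinset]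
    exact ⟨T.1, rfl, fun j => mem_branches_of_mem_goodCopies (hU hT) j.1⟩
  refine (card_le_card hsub).trans (card_image_le.trans (card_biUnion_le.trans ?_))
  refine (sum_le_card_nsmul _ _ ((Δ ^ (t + 1)) ^ (r - 1)) fun z _ => ?_).trans ?_
  · simp only [card_product, card_singleton, one_mul, Fintype.card_piFinset, prod_const, card_univ]
    have : Fintype.card {j : Fin r // j ≠ i} = r - 1 := by
      rw [Fintype.card_subtype_compl, Fintype.card_fin, Fintype.card_subtype_eq]
    rw [this]
    exact Nat.pow_le_pow_left (card_branches_le hG t z) _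
  · rw [smul_eq_mul, card_univ]
    exact Nat.mul_le_mul_right _ hG.card_left

/-- Some context is shared by many copies, relative to the number of their centres. -/
theorem exists_ctx {α β : Type} [Fintype α] [Fintype β] {G : SimpleGraph (α ⊕ β)}
    {n Δ K r t L : ℕ} (hG : AlmostRegular G n Δ K) (S : Finset (Fin r)) (i : Fin r)
    (U : Finset (TreeCopy α β r t)) (hU : U ⊆ goodCopies G r t L) (ε : ℝ) (hε : 0 < ε)
    (h : ε * n * Δ ^ (r * (t + 1)) < #U) :
    ∃ k, ε * Δ ^ (t + 1) * #(({T ∈ U | ctx S i T = k} : Finset _).image Prod.fst)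
      < #{T ∈ U | ctx S i T = k} := by
  -- Otherwise summation over the contexts bounds `#U` by `ε Δ^(t+1)` times the number of pairs of a
  -- centre and a context.
  by_contra hcon
  push Not at hcon
  have h1 : (#U : ℝ) = ∑ k ∈ U.image (ctx S i), (#{T ∈ U | ctx S i T = k} : ℝ) := by
    exact_mod_cast card_eq_sum_card_image (ctx S i) U
  have h2 : ∑ k ∈ U.image (ctx S i), #(({T ∈ U | ctx S i T = k} : Finset _).image Prod.fst)
      ≤ #(U.image fun T => (T.1, ctx S i T)) := by
    rw [card_eq_sum_card_fiberwise (f := Prod.snd) (s := U.image fun T => (T.1, ctx S i T))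
      (t := U.image (ctx S i))]
    · refine sum_le_sum fun k _ => ?_
      refine card_le_card_of_injOn (fun z => (z, k)) ?_ ?_
      · intro z hz
        obtain ⟨T, hT, rfl⟩ := mem_image.1 hz
        obtain ⟨hTU, rfl⟩ := mem_filter.1 hT
        exact mem_filter.2 ⟨mem_image_of_mem _ hTU, rfl⟩
      · intro z _ z' _ hz
        exact congrArg Prod.fst hz
    · intro ρ hρ
      obtain ⟨T, hT, rfl⟩ := mem_image.1 hρ
      exact mem_coe.2 (mem_image_of_mem _ hT)
  have h3 := h2.trans (card_centre_ctx_le hG S i U hU)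
  have h4 : (#U : ℝ) ≤ ε * Δ ^ (t + 1) * (n * (Δ ^ (t + 1)) ^ (r - 1)) := by
    rw [h1]
    refine (sum_le_sum fun k _ => hcon k).trans ?_
    rw [← mul_sum]
    gcongr
    exact_mod_cast h3
  have hr : 0 < r := i.pos
  obtain ⟨r', rfl⟩ : ∃ r', r = r' + 1 := ⟨r - 1, by omega⟩
  have h5 : ε * (Δ : ℝ) ^ (t + 1) * (n * (Δ ^ (t + 1)) ^ (r' + 1 - 1))
      = ε * n * Δ ^ ((r' + 1) * (t + 1)) := by
    rw [Nat.add_sub_cancel, mul_comm (r' + 1), pow_mul]; ring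
  linarith

/-- If many good copies are large kernels for `S`, then many are kernels for `S.erase i`. -/
theorem exists_card_isKernel_erase_ge (r t m L N : ℕ) (c ε : ℝ) (hc : 0 < c) (hε : 0 < ε) :
    ∃ C : ℝ, ∀ (α β : Type) [Fintype α] [Fintype β] (G : SimpleGraph (α ⊕ β)) (n Δ K : ℕ),
      AlmostRegular G n Δ K →
      (∀ P : Finset α, m ≤ #P → c * (#P : ℝ) ^ (t + 1) ≤ #(lightTuples G t L P)) → 0 < Δ →
      C * n ^ (t ^ 2) < (Δ : ℝ) ^ (t ^ 2 + t + 1) →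
      ∀ (S : Finset (Fin r)) (i : Fin r), i ∈ S →
      ε * n * Δ ^ (r * (t + 1)) ≤ #{T ∈ goodCopies G r t L |
        IsKernel (goodCopies G r t L) S ((r + 2) * N + m + 1) T} →
      ε / 2 * n * Δ ^ (r * (t + 1)) ≤ #{T ∈ goodCopies G r t L |
        IsKernel (goodCopies G r t L) (S.erase i) N T} := by
  obtain ⟨C, hC⟩ := pow_degree_le_of_family r t m L N c (ε / 2) hc (by positivity)
  refine ⟨C, ?_⟩
  intro α β _ _ G n Δ K hG hlight hΔ hbig S i hi hS
  by_contra hcon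
  rw [not_le] at hcon
  set 𝒯 := goodCopies G r t L with h𝒯
  -- More than `(r + 2) * N` petals allow `i` to be erased, and at least `m` petals supply the
  -- centres at each middle vertex.
  set N' := (r + 2) * N + m + 1 with hN'
  set U : Finset (TreeCopy α β r t) :=
    {T ∈ 𝒯 | IsKernel 𝒯 S N' T ∧ ¬ IsKernel 𝒯 (S.erase i) N T} with hUdef
  have hU𝒯 : U ⊆ 𝒯 := filter_subset _ _
  have hUbig : ε / 2 * n * Δ ^ (r * (t + 1)) < #U := by
    have h1 : ({T ∈ 𝒯 | IsKernel 𝒯 S N' T} : Finset _) ⊆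
        U ∪ {T ∈ 𝒯 | IsKernel 𝒯 (S.erase i) N T} := by
      intro T hT
      obtain ⟨hT, hk⟩ := mem_filter.1 hT
      rw [mem_union, mem_filter, mem_filter]
      by_cases h : IsKernel 𝒯 (S.erase i) N T
      · exact Or.inr ⟨hT, h⟩
      · exact Or.inl ⟨hT, hk, h⟩
    have h2 : (#{T ∈ 𝒯 | IsKernel 𝒯 S N' T} : ℝ)
        ≤ #U + #{T ∈ 𝒯 | IsKernel 𝒯 (S.erase i) N T} := by
      exact_mod_cast (card_le_card h1).trans (card_union_le _ _)
    linarith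
  obtain ⟨k, hk⟩ := exists_ctx hG S i U hU𝒯 (ε / 2) (by positivity) hUbig
  set V : Finset (TreeCopy α β r t) := {T ∈ U | ctx S i T = k} with hV
  have hVU : V ⊆ U := filter_subset _ _
  have hVne : V.Nonempty := by
    rw [← card_pos]
    have : (0 : ℝ) < #V := lt_of_le_of_lt (by positivity) hk
    exact_mod_cast this
  have hctx : ∀ T ∈ V, ∀ T' ∈ V, ∀ j ≠ i, (T.2 j).2 = (T'.2 j).2 ∧
      (j ∈ S → (T.2 j).1 = (T'.2 j).1) := by
    intro T hT T' hT' j hj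
    have := (mem_filter.1 hT).2.trans (mem_filter.1 hT').2.symm
    exact context_eq_iff.1 this ⟨j, hj⟩
  -- More than `N` middle vertices with the same leaves on branch `i` would make `T₀` a kernel for
  -- `S.erase i`. The petals of a member of `V` are again in `V`, keep its middle vertex on branch
  -- `i`, and have distinct centres.
  refine absurd (hC α β G n Δ K hG hlight hΔ i V (hVU.trans hU𝒯) hVne
    (fun T hT T' hT' j hj => (hctx T hT T' hT' j hj).1) ?_ ?_ hk.le) (not_le.2 hbig)
  · intro x
    by_contra hlt
    rw [not_le] at hlt
    obtain ⟨p, hp⟩ : ({p ∈ V.image fun T => T.2 i | p.2 = x} : Finset _).Nonempty :=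
      card_pos.1 (by omega)
    obtain ⟨hp, hpx⟩ := mem_filter.1 hp
    obtain ⟨T₀, hT₀, rfl⟩ := mem_image.1 hp
    refine (mem_filter.1 (hVU hT₀)).2.2 (isKernel_erase hi (N' := N') (by omega) T₀
      (({p ∈ V.image fun T => T.2 i | p.2 = x} : Finset _).image Prod.fst) ?_ ?_)
    · rw [card_image_of_injOn]
      · exact hlt.le
      · intro p hp q hq h
        exact Prod.ext h ((mem_filter.1 hp).2.trans (mem_filter.1 hq).2.symm)
    · intro y hy
      obtain ⟨p, hp, rfl⟩ := mem_image.1 hy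
      obtain ⟨hpV, hpx'⟩ := mem_filter.1 hp
      obtain ⟨T, hT, rfl⟩ := mem_image.1 hpV
      refine ⟨T, fun j => ?_, fun j hj => ?_, rfl, (mem_filter.1 (hVU hT)).2.1⟩
      · by_cases hj : j = i
        · subst hj
          exact hpx'.trans hpx.symm
        · exact (hctx T hT T₀ hT₀ j hj).1
      · exact (hctx T hT T₀ hT₀ j (ne_of_mem_erase hj)).2 (mem_of_mem_erase hj)
  · intro T hT
    have hker := (mem_filter.1 (hVU hT)).2
    obtain ⟨𝓕, h𝓕, hc𝓕, ha, hp⟩ := hker.1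
    have hsub : 𝓕 ⊆ {T' ∈ V | (T'.2 i).1 = (T.2 i).1} := by
      intro T' hT'
      have ha' := ha T' hT'
      rw [mem_filter, hV, mem_filter, hUdef, mem_filter]
      refine ⟨⟨⟨h𝓕 hT', hker.1.congr ha'.1 ha'.2, fun h => hker.2 ?_⟩, ?_⟩, ha'.2 i hi⟩
      · exact h.congr (fun j => (ha'.1 j).symm) fun j hj => (ha'.2 j (mem_of_mem_erase hj)).symm
      · rw [← (mem_filter.1 hT).2]
        exact context_eq_iff.2 fun j => ⟨ha'.1 j, ha'.2 j⟩
    refine le_trans ?_ (card_le_card (image_subset_image hsub))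
    rw [card_image_of_injOn]
    · omega
    · intro T₁ h₁ T₂ h₂ heq
      by_contra hne
      exact (hp h₁ h₂ hne).1 heq

/-- The kernel sizes needed so that all branches can be erased one by one. -/
def kernelSize (r m N : ℕ) : ℕ → ℕ
  | 0 => N
  | k + 1 => (r + 2) * kernelSize r m N k + m + 1

theorem kernelSize_le_succ (r m N k : ℕ) : kernelSize r m N k ≤ kernelSize r m N (k + 1) := by
  simp only [kernelSize]
  nlinarith [Nat.zero_le (r * kernelSize r m N k)]

/-- The branches in `S` are erased one at a time, each costing half of the density `ε`. -/
theorem exists_isKernel_empty (r t m L N : ℕ) (c ε : ℝ) (hc : 0 < c) (hε : 0 < ε) (k : ℕ) :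
    ∃ C : ℝ, ∀ (α β : Type) [Fintype α] [Fintype β] (G : SimpleGraph (α ⊕ β)) (n Δ K : ℕ),
      AlmostRegular G n Δ K →
      (∀ P : Finset α, m ≤ #P → c * (#P : ℝ) ^ (t + 1) ≤ #(lightTuples G t L P)) → 0 < Δ → 0 < n →
      C * n ^ (t ^ 2) < (Δ : ℝ) ^ (t ^ 2 + t + 1) →
      ∀ S : Finset (Fin r), #S = k →
      ε * n * Δ ^ (r * (t + 1)) ≤ #{T ∈ goodCopies G r t L |
        IsKernel (goodCopies G r t L) S (kernelSize r m N k) T} →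
      ∃ T, IsKernel (goodCopies G r t L) ∅ N T := by
  induction k generalizing ε with
  | zero =>
    refine ⟨0, ?_⟩
    intro α β _ _ G n Δ K _ _ hΔ hn _ S hS hbig
    obtain rfl := card_eq_zero.1 hS
    have hpos : (0 : ℝ) < ε * n * Δ ^ (r * (t + 1)) := by positivity
    obtain ⟨T, hT⟩ := card_pos.1 (Nat.cast_pos.1 (hpos.trans_le hbig))
    exact ⟨T, (mem_filter.1 hT).2⟩
  | succ k ih =>
    obtain ⟨C₁, h₁⟩ := exists_card_isKernel_erase_ge r t m L (kernelSize r m N k) c ε hc hε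
    obtain ⟨C₂, h₂⟩ := ih (ε / 2) (by positivity)
    refine ⟨max C₁ C₂, ?_⟩
    intro α β _ _ G n Δ K hG hlight hΔ hn hbig S hS hcard
    have hnp : (0 : ℝ) ≤ n ^ (t ^ 2) := by positivity
    obtain ⟨i, hi⟩ : S.Nonempty := card_pos.1 (by omega)
    refine h₂ α β G n Δ K hG hlight hΔ hn
      (lt_of_le_of_lt (mul_le_mul_of_nonneg_right (le_max_right _ _) hnp) hbig) (S.erase i)
      (by rw [card_erase_of_mem hi, hS]; rfl)
      (h₁ α β G n Δ K hG hlight hΔ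
        (lt_of_le_of_lt (mul_le_mul_of_nonneg_right (le_max_left _ _) hnp) hbig) S i hi hcard)

/-! ### The almost regular case -/

/-- Almost regular, sufficiently dense, `K_{s,s}`-free graphs contain an induced `F^ℓ_{r,t}`. -/
theorem exists_hasPower_of_almostRegular (s r t ℓ K : ℕ) (hs : 1 ≤ s) (hr : 1 ≤ r) (hK : 0 < K) :
    ∃ C : ℝ, 0 < C ∧ ∀ (α β : Type) [Fintype α] [Fintype β] (G : SimpleGraph (α ⊕ β)) (n Δ : ℕ),
      AlmostRegular G n Δ K → (completeBipartiteGraph (Fin s) (Fin s)).Free G → 0 < n → C ≤ Δ →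
      C * n ^ (t ^ 2) ≤ (Δ : ℝ) ^ (t ^ 2 + t + 1) →
      C * (n : ℝ) ^ (r * t) ≤ n * Δ ^ (r * (t + 1)) → HasPower G r t ℓ := by
  obtain ⟨L, m, c, hc, hlight⟩ := exists_card_lightTuples_ge s r t ℓ hs
  obtain ⟨c', D, hc', hcount⟩ := exists_card_goodCopies_ge s r t m K hs hr hK c hc
  obtain ⟨N, hN⟩ := exists_hasPower_of_isKernel s r t ℓ hs
  -- Half of the guaranteed good copies may lie in no sunflower; the other half is shared among the
  -- `2^r` sets `S`.
  set ε : ℝ := c' / 2 / 2 ^ r with hε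
  have hε0 : 0 < ε := by positivity
  choose Ck hCk using exists_isKernel_empty r t m L N c ε hc hε0
  set M := sunflowerBound (kernelSize r m N r * L ^ r) (kernelSize r m N r * (r * r)) r with hM
  obtain ⟨C₀, hC₀⟩ : ∃ C₀ : ℝ, ∀ k ∈ range (r + 1), Ck k ≤ C₀ := by
    obtain ⟨C₀, hC₀⟩ := ((range (r + 1)).image Ck).exists_le
    exact ⟨C₀, fun k hk => hC₀ _ (mem_image_of_mem _ hk)⟩
  -- `|C₀| + 1` gives the strict inequality for erasing branches, `D` the count of good copies, and
  -- `2 * M / c'` makes the copies in no sunflower at most half.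
  refine ⟨|C₀| + 1 + D + 2 * M / c', by positivity, ?_⟩
  intro α β _ _ G n Δ hG hfree hn hΔ h1 h2
  have hDp : (0 : ℝ) ≤ D := by positivity
  have hMp : (0 : ℝ) ≤ 2 * M / c' := by positivity
  have hCp := abs_nonneg C₀
  have hCle := le_abs_self C₀
  by_contra hpow
  have hΔ0 : 0 < Δ := by
    have : (0 : ℝ) < Δ := by linarith
    exact_mod_cast this
  have hDΔ : D ≤ Δ := by
    have : (D : ℝ) ≤ Δ := by linarith
    exact_mod_cast this
  have hnr : (0 : ℝ) < n := by exact_mod_cast hn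
  have hl := hlight α β G hfree hpow
  have hgood := hcount α β G n Δ L hG hfree hl hDΔ
  set 𝒯 := goodCopies G r t L with h𝒯
  have hker : ∀ T, ¬ IsKernel 𝒯 ∅ N T := fun T hT => hpow (hN α β G L T hfree hT)
  have hmono : ∀ k, k ≤ r → kernelSize r m N k ≤ kernelSize r m N r :=
    fun k hk => monotone_nat_of_le_succ (kernelSize_le_succ r m N) hk
  have hnot : (#{T ∈ 𝒯 | ∀ S, ¬ IsKernel 𝒯 S (kernelSize r m N r) T} : ℝ)
      ≤ c' / 2 * n * Δ ^ (r * (t + 1)) := by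
    have h3 : (#{T ∈ 𝒯 | ∀ S, ¬ IsKernel 𝒯 S (kernelSize r m N r) T} : ℝ)
        ≤ M * (Fintype.card α : ℝ) ^ (r * t) := by
      exact_mod_cast card_not_isKernel_le (G := G) (r := r) (t := t) (L := L) (kernelSize r m N r)
    have h4 : (Fintype.card α : ℝ) ^ (r * t) ≤ n ^ (r * t) := by
      gcongr
      exact hG.card_left
    have h5 : 2 * M / c' * (n : ℝ) ^ (r * t) ≤ n * Δ ^ (r * (t + 1)) := by
      refine le_trans ?_ h2
      gcongr
      linarith
    calc (#{T ∈ 𝒯 | ∀ S, ¬ IsKernel 𝒯 S (kernelSize r m N r) T} : ℝ)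
        ≤ M * (n : ℝ) ^ (r * t) := h3.trans (by gcongr)
      _ = c' / 2 * (2 * M / c' * (n : ℝ) ^ (r * t)) := by field_simp
      _ ≤ c' / 2 * (n * Δ ^ (r * (t + 1))) := by gcongr
      _ = _ := by ring
  have hcov : 𝒯 ⊆ ({T ∈ 𝒯 | ∀ S, ¬ IsKernel 𝒯 S (kernelSize r m N r) T} : Finset _) ∪
      (univ : Finset (Finset (Fin r))).biUnion fun S =>
        {T ∈ 𝒯 | IsKernel 𝒯 S (kernelSize r m N #S) T} := by
    intro T hT
    rw [mem_union, mem_filter, mem_biUnion]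
    by_cases h : ∀ S, ¬ IsKernel 𝒯 S (kernelSize r m N r) T
    · exact Or.inl ⟨hT, h⟩
    · push Not at h
      obtain ⟨S, hS⟩ := h
      exact Or.inr ⟨S, mem_univ _, mem_filter.2 ⟨hT, hS.mono
        (hmono _ (by simpa using card_le_univ S))⟩⟩
  have hsmall : ∀ S : Finset (Fin r), (#{T ∈ 𝒯 | IsKernel 𝒯 S (kernelSize r m N #S) T} : ℝ)
      < ε * n * Δ ^ (r * (t + 1)) := by
    intro S
    by_contra hge
    rw [not_lt] at hge
    have hC : Ck #S * n ^ (t ^ 2) < (Δ : ℝ) ^ (t ^ 2 + t + 1) := by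
      refine lt_of_lt_of_le ?_ h1
      have := hC₀ #S (by rw [mem_range]; have := card_le_univ S; simp at this; omega)
      gcongr
      linarith
    obtain ⟨T, hT⟩ := hCk #S α β G n Δ K hG hl hΔ0 hn hC S rfl hge
    exact hker T hT
  have htot : (#𝒯 : ℝ) ≤ (#{T ∈ 𝒯 | ∀ S, ¬ IsKernel 𝒯 S (kernelSize r m N r) T} : ℝ) +
      ∑ S : Finset (Fin r), (#{T ∈ 𝒯 | IsKernel 𝒯 S (kernelSize r m N #S) T} : ℝ) := by
    exact_mod_cast (card_le_card hcov).trans ((card_union_le _ _).trans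
      (Nat.add_le_add_left card_biUnion_le _))
  have hsum : ∑ S : Finset (Fin r), (#{T ∈ 𝒯 | IsKernel 𝒯 S (kernelSize r m N #S) T} : ℝ)
      < ∑ _S : Finset (Fin r), ε * n * Δ ^ (r * (t + 1)) :=
    sum_lt_sum_of_nonempty univ_nonempty fun S _ => hsmall S
  rw [sum_const, nsmul_eq_mul, card_univ, Fintype.card_finset, Fintype.card_fin] at hsum
  have he : ((2 ^ r : ℕ) : ℝ) * (ε * n * Δ ^ (r * (t + 1))) = c' / 2 * n * Δ ^ (r * (t + 1)) := by
    rw [hε]; push_cast; field_simp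
  rw [he] at hsum
  linarith

/-! ### Passing to an almost regular piece -/

theorem exists_balanced_colouring {V : Type} (U : Finset V) (k : ℕ) (hk : 0 < k) :
    ∃ φ : V → Fin k, ∀ i, #{v ∈ U | φ v = i} ≤ #U / k + 1 := by
  let idx : V → ℕ := fun v => if h : v ∈ U then (U.equivFin ⟨v, h⟩).val else 0
  have hinj : Set.InjOn idx U := by
    intro v hv w hw h
    simp only [idx, dif_pos (mem_coe.1 hv), dif_pos (mem_coe.1 hw)] at h
    exact congrArg Subtype.val (U.equivFin.injective (Fin.ext h))
  have hlt : ∀ v ∈ U, idx v < #U := by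
    intro v hv
    simp only [idx, dif_pos hv]
    exact Fin.is_lt _
  refine ⟨fun v => ⟨idx v % k, Nat.mod_lt _ hk⟩, fun i => ?_⟩
  have : #{v ∈ U | (⟨idx v % k, Nat.mod_lt _ hk⟩ : Fin k) = i} ≤ #(range (#U / k + 1)) := by
    refine card_le_card_of_injOn (fun v => idx v / k) ?_ ?_
    · intro v hv
      have := hlt v (mem_filter.1 hv).1
      rw [mem_coe, mem_range, Nat.lt_succ_iff]
      exact Nat.div_le_div_right this.le
    · intro v hv w hw h
      obtain ⟨hv, hvi⟩ := mem_filter.1 hv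
      obtain ⟨hw, hwi⟩ := mem_filter.1 hw
      have hmod : idx v % k = idx w % k := by
        have := hvi.trans hwi.symm
        simpa using this
      refine hinj hv hw ?_
      rw [← Nat.div_add_mod (idx v) k, ← Nat.div_add_mod (idx w) k, hmod, show idx v / k = idx w / k from h]
  simpa using this

/-- The number of related pairs in `U`. -/
noncomputable def pairCount {V : Type} (E : V → V → Prop) (U : Finset V) : ℕ :=
  #{p ∈ U ×ˢ U | E p.1 p.2}

theorem pairCount_eq_sum_out {V : Type} (E : V → V → Prop) (U : Finset V) :
    pairCount E U = ∑ v ∈ U, #{w ∈ U | E v w} := by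
  simp only [pairCount, card_filter, sum_product]

theorem pairCount_eq_sum_in {V : Type} (E : V → V → Prop) (U : Finset V) :
    pairCount E U = ∑ v ∈ U, #{w ∈ U | E w v} := by
  simp only [pairCount, card_filter, sum_product_right]

/-- Passing to an almost regular subgraph. -/
theorem exists_almost_regular_subset (a : ℝ) (ha : 0 < a) (ha1 : a < 1) :
    ∃ K : ℕ, 0 < K ∧ ∀ (C : ℝ), (K : ℝ) ≤ C → ∀ (V : Type) [Fintype V] (E : V → V → Prop),
      C * (Fintype.card V : ℝ) ^ (1 + a) < pairCount E univ →
      ∃ (U : Finset V) (m Δ : ℕ), 0 < m ∧ #U ≤ m ∧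
        (∀ v ∈ U, #{w ∈ U | E v w} ≤ Δ ∧ #{w ∈ U | E w v} ≤ Δ) ∧
        m * Δ ≤ K * pairCount E U ∧ C * (m : ℝ) ^ a ≤ Δ := by
  -- `18 = 2 * 9`, where 9 bounds `3^(1+a)` and the factor 2 comes from discarding half of the
  -- pairs.
  obtain ⟨k, hk⟩ : ∃ k : ℕ, 18 < (k : ℝ) ^ a :=
    ((tendsto_rpow_atTop ha).comp tendsto_natCast_atTop_atTop).eventually_gt_atTop 18 |>.exists
  have hk0 : 0 < k := by
    rcases Nat.eq_zero_or_pos k with rfl | h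
    · rw [Nat.cast_zero, Real.zero_rpow ha.ne'] at hk; norm_num at hk
    · exact h
  have hkr : (0 : ℝ) < k := by exact_mod_cast hk0
  refine ⟨4 * k + 2, by omega, ?_⟩
  intro C hC V _ E hlt
  push_cast at hC
  have hC0 : 0 < C := by linarith
  have hVne : Nonempty V := by
    by_contra hne
    rw [not_nonempty_iff] at hne
    simp only [pairCount, univ_eq_empty, empty_product, filter_empty, card_empty, Nat.cast_zero] at hlt
    have : (0 : ℝ) ≤ C * (Fintype.card V : ℝ) ^ (1 + a) := by positivity
    linarith
  -- Extremal choice: every subset then satisfies the density bound `hle` with the constant `C'`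
  -- attained by `U₀`.
  obtain ⟨U₀, hU₀, hmax⟩ := exists_max_image ({U | U.Nonempty} : Finset (Finset V))
    (fun U => (pairCount E U : ℝ) / (#U : ℝ) ^ (1 + a)) ⟨univ, by simp⟩
  have hU₀ : U₀.Nonempty := (mem_filter.1 hU₀).2
  set m := #U₀ with hm
  have hm0 : 0 < m := card_pos.2 hU₀
  have hm1 : (1 : ℝ) ≤ m := by exact_mod_cast hm0
  have hmr : (0 : ℝ) < m := by linarith
  set C' : ℝ := (pairCount E U₀ : ℝ) / (m : ℝ) ^ (1 + a) with hC'
  have hCC' : C < C' := by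
    have h1 := hmax univ (by simp)
    refine lt_of_lt_of_le ?_ h1
    have : (0 : ℝ) < (#(univ : Finset V) : ℝ) := by exact_mod_cast card_pos.2 univ_nonempty
    rw [lt_div_iff₀ (by positivity), card_univ]
    exact hlt
  have hC'0 : 0 < C' := hC0.trans hCC'
  have hle : ∀ U : Finset V, (pairCount E U : ℝ) ≤ C' * (#U : ℝ) ^ (1 + a) := by
    intro U
    rcases U.eq_empty_or_nonempty with rfl | hU
    · simp only [pairCount, empty_product, filter_empty, card_empty, Nat.cast_zero]
      positivity
    · have h1 := hmax U (by simpa using hU)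
      have : (0 : ℝ) < (#U : ℝ) := by exact_mod_cast card_pos.2 hU
      rwa [div_le_iff₀ (by positivity)] at h1
  set μ : ℝ := C' * (m : ℝ) ^ a with hμ
  have hma : (1 : ℝ) ≤ (m : ℝ) ^ a := Real.one_le_rpow hm1 ha.le
  have hμ1 : 1 ≤ μ := by nlinarith
  have heq : (pairCount E U₀ : ℝ) = μ * m := by
    rw [hμ, mul_assoc, ← Real.rpow_add_one hmr.ne', add_comm a 1, hC',
      div_mul_cancel₀ _ (by positivity)]
  clear_value C'
  clear hC'
  have hkm : (k : ℝ) ≤ m := by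
    have h1 : (pairCount E U₀ : ℝ) ≤ m * m := by
      have : pairCount E U₀ ≤ m * m := (card_filter_le _ _).trans (by rw [card_product])
      exact_mod_cast this
    rw [heq] at h1
    have h2 := le_of_mul_le_mul_right h1 hmr
    have h3 : C' ≤ μ := by nlinarith
    linarith
  set deg : V → ℕ := fun v => #{w ∈ U₀ | E v w} + #{w ∈ U₀ | E w v} with hdeg
  have hdegsum : ∑ v ∈ U₀, (deg v : ℝ) = 2 * (μ * m) := by
    rw [← heq]
    have : ∑ v ∈ U₀, deg v = 2 * pairCount E U₀ := by
      rw [two_mul, sum_add_distrib, ← pairCount_eq_sum_out, ← pairCount_eq_sum_in]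
    exact_mod_cast this
  -- The average of `deg` on `U₀` is `2 * μ`, so at most `m / k` vertices exceed it by a factor `k`.
  set H : Finset V := {v ∈ U₀ | 2 * k * μ < deg v} with hH
  have hHcard : (k : ℝ) * #H ≤ m := by
    have h1 : ∑ _v ∈ H, 2 * k * μ ≤ ∑ v ∈ U₀, (deg v : ℝ) :=
      (sum_le_sum fun v hv => (mem_filter.1 hv).2.le).trans
        (sum_le_sum_of_subset_of_nonneg (filter_subset _ _) fun _ _ _ => by positivity)
    rw [sum_const, nsmul_eq_mul, hdegsum] at h1
    have h2 : (2 * μ) * (k * #H) ≤ (2 * μ) * m := by linarith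
    exact le_of_mul_le_mul_left h2 (by positivity)
  by_cases hcase : (pairCount E U₀ : ℝ) / 2 ≤ pairCount E (U₀ \ H)
  · refine ⟨U₀ \ H, m, ⌈2 * k * μ⌉₊, hm0, card_le_card sdiff_subset, ?_, ?_, ?_⟩
    · intro v hv
      obtain ⟨hv0, hvH⟩ := mem_sdiff.1 hv
      have h1 : (deg v : ℝ) ≤ 2 * k * μ := by
        by_contra hgt
        exact hvH (mem_filter.2 ⟨hv0, not_le.1 hgt⟩)
      have h2 : deg v ≤ ⌈2 * k * μ⌉₊ := by exact_mod_cast h1.trans (Nat.le_ceil _)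
      have h3 : #{w ∈ U₀ \ H | E v w} ≤ #{w ∈ U₀ | E v w} :=
        card_le_card (filter_subset_filter _ sdiff_subset)
      have h4 : #{w ∈ U₀ \ H | E w v} ≤ #{w ∈ U₀ | E w v} :=
        card_le_card (filter_subset_filter _ sdiff_subset)
      simp only [hdeg] at h2
      omega
    · have h1 : (⌈2 * k * μ⌉₊ : ℝ) ≤ (2 * k + 1) * μ := by
        have := (Nat.ceil_lt_add_one (show (0 : ℝ) ≤ 2 * k * μ by positivity)).le
        linarith
      have h2 : (m * ⌈2 * k * μ⌉₊ : ℝ) ≤ (4 * k + 2) * pairCount E (U₀ \ H) := by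
        calc (m * ⌈2 * k * μ⌉₊ : ℝ) ≤ m * ((2 * k + 1) * μ) := by gcongr
          _ = (4 * k + 2) * (pairCount E U₀ / 2) := by rw [heq]; ring
          _ ≤ _ := by gcongr
      exact_mod_cast h2
    · refine le_trans ?_ (Nat.le_ceil _)
      have h1 : (1 : ℝ) ≤ k := by exact_mod_cast hk0
      calc C * (m : ℝ) ^ a ≤ μ := by rw [hμ]; gcongr
        _ ≤ 2 * k * μ := by nlinarith
  -- More than half of the pairs meet `H`. Adding `H` to each of `k` balanced colour classes gives
  -- sets of at most `3 * m / k` vertices that together contain all these pairs, but extremality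
  -- allows such sets too few.
  · exfalso
    rw [not_le] at hcase
    obtain ⟨φ, hφ⟩ := exists_balanced_colouring U₀ k hk0
    set P : Fin k → Finset V := fun i => H ∪ {v ∈ U₀ | φ v = i} with hP
    have hPcard : ∀ i, (#(P i) : ℝ) ≤ 3 * m / k := by
      intro i
      have h1 : #(P i) ≤ #H + (m / k + 1) := (card_union_le _ _).trans (Nat.add_le_add_left (hφ i) _)
      have h2 : (#(P i) : ℝ) ≤ #H + (((m / k : ℕ) : ℝ) + 1) := by exact_mod_cast h1
      have h3 : ((m / k : ℕ) : ℝ) ≤ m / k := Nat.cast_div_le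
      have h4 : (#H : ℝ) ≤ m / k := by rw [le_div_iff₀ hkr]; linarith
      have h5 : (1 : ℝ) ≤ m / k := by rwa [one_le_div hkr]
      have h6 : (3 * m / k : ℝ) = 3 * (m / k) := by ring
      rw [h6]; linarith
    have hcov : ({p ∈ U₀ ×ˢ U₀ | E p.1 p.2} : Finset (V × V)) ⊆
        ({p ∈ (U₀ \ H) ×ˢ (U₀ \ H) | E p.1 p.2} : Finset (V × V)) ∪
        univ.biUnion fun i => ({p ∈ P i ×ˢ P i | E p.1 p.2} : Finset (V × V)) := by
      rintro ⟨v, w⟩ hp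
      simp only [mem_filter, mem_product] at hp
      obtain ⟨⟨hv, hw⟩, hE⟩ := hp
      simp only [mem_union, mem_biUnion, mem_filter, mem_product, mem_sdiff, hP, mem_univ, true_and]
      by_cases hvH : v ∈ H
      · exact Or.inr ⟨φ w, ⟨Or.inl hvH, Or.inr ⟨hw, rfl⟩⟩, hE⟩
      · by_cases hwH : w ∈ H
        · exact Or.inr ⟨φ v, ⟨Or.inr ⟨hv, rfl⟩, Or.inl hwH⟩, hE⟩
        · exact Or.inl ⟨⟨⟨hv, hvH⟩, hw, hwH⟩, hE⟩
    have h1 : (pairCount E U₀ : ℝ) ≤ pairCount E (U₀ \ H) + ∑ i, (pairCount E (P i) : ℝ) := by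
      exact_mod_cast (card_le_card hcov).trans ((card_union_le _ _).trans
        (Nat.add_le_add_left card_biUnion_le _))
    have h2 : ∑ i, (pairCount E (P i) : ℝ) ≤ k * (C' * (3 * m / k) ^ (1 + a)) := by
      refine (sum_le_card_nsmul _ _ (C' * (3 * m / k) ^ (1 + a)) fun i _ => ?_).trans ?_
      · refine (hle (P i)).trans ?_
        gcongr
        exact hPcard i
      · simp
    have h3 : (k : ℝ) * (C' * (3 * m / k) ^ (1 + a)) * k ^ a = 3 ^ (1 + a) * (μ * m) := by
      have e1 : (m : ℝ) ^ (1 + a) = m * m ^ a := by rw [Real.rpow_add hmr, Real.rpow_one]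
      have e2 : (k : ℝ) ^ (1 + a) = k * k ^ a := by rw [Real.rpow_add hkr, Real.rpow_one]
      have e3 : (k : ℝ) ^ a ≠ 0 := (Real.rpow_pos_of_pos hkr a).ne'
      rw [Real.div_rpow (by positivity) hkr.le, Real.mul_rpow (by norm_num) hmr.le, e1, e2, hμ]
      field_simp
    have h4 : (3 : ℝ) ^ (1 + a) ≤ 9 := by
      calc (3 : ℝ) ^ (1 + a) ≤ 3 ^ (2 : ℝ) :=
            Real.rpow_le_rpow_of_exponent_le (by norm_num) (by linarith)
        _ = 9 := by norm_num
    have h5 : μ * m / 2 < k * (C' * (3 * m / k) ^ (1 + a)) := by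
      rw [heq] at h1 hcase
      linarith
    have hμm : 0 < μ * m := by positivity
    have h6 : μ * m / 2 * 18 < 9 * (μ * m) := by
      calc μ * m / 2 * 18 ≤ μ * m / 2 * k ^ a := by gcongr
        _ < k * (C' * (3 * m / k) ^ (1 + a)) * k ^ a := by
            gcongr
        _ = 3 ^ (1 + a) * (μ * m) := h3
        _ ≤ 9 * (μ * m) := by gcongr
    linarith

/-! ### Assembly -/

theorem ncard_between_edgeSet_le {V : Type} [Fintype V] (G : SimpleGraph V) (X : Set V) :
    (G.between X Xᶜ).edgeSet.ncard ≤
      pairCount (fun v w => v ∈ X ∧ w ∉ X ∧ G.Adj v w) univ := by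
  have hsub : (G.between X Xᶜ).edgeSet ⊆
      ((({p ∈ univ ×ˢ univ | p.1 ∈ X ∧ p.2 ∉ X ∧ G.Adj p.1 p.2} : Finset (V × V)).image
        fun p => s(p.1, p.2) : Finset (Sym2 V)) : Set (Sym2 V)) := by
    intro e
    induction e using Sym2.ind with
    | _ v w =>
      intro h
      rw [SimpleGraph.mem_edgeSet, SimpleGraph.between_adj] at h
      rw [mem_coe, mem_image]
      rcases h.2 with h' | h'
      · exact ⟨(v, w), by simpa using ⟨h'.1, h'.2, h.1⟩, rfl⟩
      · exact ⟨(w, v), by simpa using ⟨h'.2, h'.1, h.1.symm⟩, Sym2.eq_swap⟩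
  refine (Set.ncard_le_ncard hsub (finite_toSet _)).trans ?_
  rw [Set.ncard_coe_finset]
  refine card_image_le.trans (le_of_eq ?_)
  rw [pairCount]
  congr!

/-- The graph spanned by the two sides of a vertex subset is almost regular. -/
theorem almostRegular_comap {V : Type} [Fintype V] [DecidableEq V] (G : SimpleGraph V) (X : Set V)
    (E : V → V → Prop) (hE : ∀ v w, E v w ↔ v ∈ X ∧ w ∉ X ∧ G.Adj v w) (U : Finset V)
    (m Δ K : ℕ) (hU : #U ≤ m)
    (hdeg : ∀ v ∈ U, #{w ∈ U | E v w} ≤ Δ ∧ #{w ∈ U | E w v} ≤ Δ)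
    (hedges : m * Δ ≤ K * pairCount E U) :
    AlmostRegular (α := {v // v ∈ U ∧ v ∈ X}) (β := {v // v ∈ U ∧ v ∉ X})
      (G.comap (Sum.elim Subtype.val Subtype.val)) m Δ K where
  card_left := by
    rw [Fintype.card_subtype]
    exact (card_le_card fun v hv => (mem_filter.1 hv).2.1).trans hU
  card_right := by
    rw [Fintype.card_subtype]
    exact (card_le_card fun v hv => (mem_filter.1 hv).2.1).trans hU
  nbrsL_le b := by
    refine le_trans (card_le_card_of_injOn Subtype.val ?_ Subtype.val_injective.injOn)
      (hdeg b.1 b.2.1).2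
    intro v hv
    exact mem_filter.2 ⟨v.2.1, (hE _ _).2 ⟨v.2.2, b.2.2, (mem_filter.1 hv).2⟩⟩
  nbrsR_le b := by
    refine le_trans (card_le_card_of_injOn Subtype.val ?_ Subtype.val_injective.injOn)
      (hdeg b.1 b.2.1).1
    intro v hv
    exact mem_filter.2 ⟨v.2.1, (hE _ _).2 ⟨b.2.2, v.2.2, (mem_filter.1 hv).2⟩⟩
  edges_ge := by
    refine hedges.trans (Nat.mul_le_mul_left _ ?_)
    have h1 : pairCount E U ≤
        #(({p : {v // v ∈ U ∧ v ∈ X} × {v // v ∈ U ∧ v ∉ X} | G.Adj p.1.1 p.2.1} :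
          Finset _).image fun p => (p.1.1, p.2.1)) := by
      refine card_le_card ?_
      rintro ⟨v, w⟩ hp
      simp only [mem_filter, mem_product, hE] at hp
      obtain ⟨⟨hv, hw⟩, hvX, hwX, hadj⟩ := hp
      exact mem_image.2 ⟨(⟨v, hv, hvX⟩, ⟨w, hw, hwX⟩), mem_filter.2 ⟨mem_univ _, hadj⟩, rfl⟩
    refine h1.trans (card_image_le.trans (le_of_eq ?_))
    rw [card_filter, Fintype.sum_prod_type_right]
    refine sum_congr rfl fun b _ => ?_
    rw [nbrsL, card_filter]
    rfl

/-- The value of `a` is the one for which `Δ ≥ C m^a` gives the sunflower condition `m Δ^(r(t+1)) ≥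
C₀ m^(rt)`. The condition for erasing branches, `a(t²+t+1) ≥ t²`, is weaker in the present range of
`r`. -/
theorem exists_isThreshold (ℓ r s t : ℕ) (hs : 1 ≤ s) (ht : 1 ≤ t) (hr : t + 2 ≤ r) :
    ∃ C : ℝ, 0 < C ∧ ∀ n : ℕ, IsThreshold n (heightTwoPower r t ℓ) s
      ⌊C * (n : ℝ) ^ (2 - ((r : ℝ) + 1) / ((r : ℝ) * t + r))⌋₊ := by
  have htr : (1 : ℝ) ≤ t := by exact_mod_cast ht
  have hrr : (t : ℝ) + 2 ≤ r := by exact_mod_cast hr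
  have hr0 : (0 : ℝ) < r := by linarith
  set a : ℝ := (r * t - 1) / (r * (t + 1)) with ha
  have hrt : (1 : ℝ) < r * t := by nlinarith
  have ha0 : 0 < a := div_pos (by linarith) (by positivity)
  have ha1 : a < 1 := by rw [ha, div_lt_one (by positivity)]; linarith
  have hexp : 2 - ((r : ℝ) + 1) / ((r : ℝ) * t + r) = 1 + a := by
    rw [ha]
    have : (r : ℝ) * t + r = r * (t + 1) := by ring
    rw [this]
    field_simp
    ring
  obtain ⟨K, hK, hreg⟩ := exists_almost_regular_subset a ha0 ha1
  obtain ⟨C₀, hC₀, hcore⟩ := exists_hasPower_of_almostRegular s r t ℓ K hs (by omega) hK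
  have hKr : (1 : ℝ) ≤ K := by exact_mod_cast hK
  set C := C₀ + K with hCdef
  have hC1 : 1 ≤ C := by linarith
  refine ⟨C, by linarith, fun n G X hfree hlt => ?_⟩
  rw [hexp] at hlt
  have h1 : C * (n : ℝ) ^ (1 + a) < pairCount (fun v w => v ∈ X ∧ w ∉ X ∧ G.Adj v w) univ := by
    refine lt_of_lt_of_le (Nat.lt_of_floor_lt hlt) ?_
    exact_mod_cast ncard_between_edgeSet_le G X
  obtain ⟨U, m, Δ, hm, hUm, hdeg, hedges, hΔ⟩ := hreg C (by linarith) (Fin n) _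
    (by rwa [Fintype.card_fin])
  have hAR := almostRegular_comap G X _ (fun _ _ => Iff.rfl) U m Δ K hUm hdeg hedges
  have hm1 : (1 : ℝ) ≤ m := by exact_mod_cast hm
  have hm0 : (0 : ℝ) < m := by linarith
  have hpow : ∀ q : ℕ, 1 ≤ q → C₀ * (m : ℝ) ^ (a * q) ≤ (Δ : ℝ) ^ q := by
    intro q hq
    calc C₀ * (m : ℝ) ^ (a * q) ≤ C ^ q * (m : ℝ) ^ (a * q) := by
          gcongr
          calc C₀ ≤ C := by linarith
            _ = C ^ 1 := (pow_one C).symm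
            _ ≤ C ^ q := pow_le_pow_right₀ hC1 hq
      _ = (C * (m : ℝ) ^ a) ^ q := by rw [mul_pow, Real.rpow_mul_natCast hm0.le]
      _ ≤ _ := by gcongr
  have hinj : Injective (Sum.elim (Subtype.val : {v // v ∈ U ∧ v ∈ X} → Fin n)
      (Subtype.val : {v // v ∈ U ∧ v ∉ X} → Fin n)) := by
    rintro (v | v) (w | w) h
    · exact congrArg _ (Subtype.ext h)
    · exact absurd (show v.1 = w.1 from h) fun h => w.2.2 (h ▸ v.2.2)
    · exact absurd (show v.1 = w.1 from h) fun h => v.2.2 (h ▸ w.2.2)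
    · exact congrArg _ (Subtype.ext h)
  refine HasPower.hasInducedCopyAcross (α := {v // v ∈ U ∧ v ∈ X}) (β := {v // v ∈ U ∧ v ∉ X})
    (by omega) ht G X Subtype.val Subtype.val hinj (fun v => v.2.2) (fun v => v.2.2)
    (hcore _ _ _ m Δ hAR ?_ hm ?_ ?_ ?_)
  · intro hcon
    exact hfree (hcon.trans ⟨(SimpleGraph.Embedding.comap ⟨_, hinj⟩ G).toCopy⟩)
  · refine le_trans ?_ hΔ
    have := Real.one_le_rpow hm1 ha0.le
    nlinarith
  · refine le_trans ?_ (hpow (t ^ 2 + t + 1) (by omega))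
    gcongr
    rw [← Real.rpow_natCast]
    refine Real.rpow_le_rpow_of_exponent_le hm1 ?_
    rw [ha, div_mul_eq_mul_div, le_div_iff₀ (by positivity)]
    push_cast
    -- This is `rt ≥ t² + t + 1`, which follows from `(t-1)(r-t-2) ≥ 0` and `r ≥ 3`.
    nlinarith [mul_nonneg (sub_nonneg.2 htr) (sub_nonneg.2 hrr)]
  · have h2 := hpow (r * (t + 1)) (Nat.mul_pos (by omega) (by omega))
    have h3 : a * ((r * (t + 1) : ℕ) : ℝ) = (r * t : ℕ) - 1 := by
      rw [ha]; push_cast; field_simp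
    rw [h3, Real.rpow_sub_one hm0.ne', Real.rpow_natCast] at h2
    calc C₀ * (m : ℝ) ^ (r * t) = m * (C₀ * ((m : ℝ) ^ (r * t) / m)) := by field_simp
      _ ≤ m * Δ ^ (r * (t + 1)) := by gcongr

end InducedTuran

theorem theorem2p3 (ℓ r s t : ℕ) (hℓ : 1 ≤ ℓ) (hs : 1 ≤ s) (ht : 3 ≤ t + 2) (hr : t + 2 ≤ r) :
    (fun n : ℕ => (InducedTuran.exBip n (InducedTuran.heightTwoPower r t ℓ) s : ℝ))
      =O[Filter.atTop]
    (fun n : ℕ => (n : ℝ) ^ (2 - ((r : ℝ) + 1) / ((r : ℝ) * (t : ℝ) + (r : ℝ)))) := by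
  obtain ⟨C, hC, h⟩ := InducedTuran.exists_isThreshold ℓ r s t hs (by omega) hr
  refine Asymptotics.IsBigO.of_bound C (Filter.Eventually.of_forall fun n => ?_)
  have hn : (0 : ℝ) ≤ (n : ℝ) ^ (2 - ((r : ℝ) + 1) / ((r : ℝ) * (t : ℝ) + (r : ℝ))) := by positivity
  rw [Real.norm_of_nonneg (Nat.cast_nonneg _), Real.norm_of_nonneg hn]
  refine le_trans ?_ (Nat.floor_le (mul_nonneg hC.le hn))
  exact Nat.cast_le.2 (Nat.sInf_le (h n))
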